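/- \textbf{Setting.} Let $(\mathbb B,\|\cdot\|)$ be a separable real Banach space and $\beta>0$ such that $\|x+y\|^2+\|x-y\|^2\le 2\|x\|^2+2\beta^2\|y\|^2$ for all $x,y\in\mathbb B$. Let $1<p\le 2$, $v>0$, $\mu\in\mathbb B$, and let $(X_n)_{n\ge1}$ be $\mathbb B$-valued integrable random variables adapted to a filtration $(\mathcal F_n)_{n\ge 0}$ with $\mathbb E(X_n\mid\mathcal F_{n-1})=\mu$ and $\mathbb E(\|X_n-\mu\|^p\mid\mathcal F_{n-1})\le v$ almost surely for all $n\ge1$. For $x\neq0$ put $\mathtt{Trunc}(x)=(1\wedge\|x\|)/\|x\|$, and for $0\le k<n$, $\lambda>0$ and an $\mathcal F_k$-measurable initial estimate $\widehat Z_k$ let $$\widehat\mu_n(k)=\widehat\mu_n(k,\lambda,\widehat Z_k)=\frac1{n-k}\sum_{m=k+1}^n\Big\{\mathtt{Trunc}\big(\lambda(X_m-\widehat Z_k)\big)(X_m-\widehat Z_k)+\widehat Z_k\Big\}.$$ Put $K_p=\frac1p\big(\frac{p-1}p\big)^{p-1}$, let $\mathfrak C_p(\mathbb B)=a\,\frac{e^{2/\beta}-2/\beta-1}{(2/\beta)^2}$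 with $a=2^{p-1}$ if $\mathbb B$ is a Hilbert space and $a=2^{p+1}$ otherwise, and let $C_p=\mathfrak C_p(\mathbb B)+\beta^{-1}K_p2^{p-1}$. Let $\delta=\delta_1+\delta_2\le1$ with $\delta_1,\delta_2>0$. For a number $r\ge 0$ let $$\lambda(r)=\left(\frac{\beta\log(2/\delta_1)}{(n-k)\,(\beta\mathfrak C_p(\mathbb B)+K_p2^{p-1})\,(v+r^p)}\right)^{1/p}.$$ \textbf{(1)} Let $0\le k<n$, let $\widehat Z_k$ be $\mathcal F_k$-measurable and let $r\ge0$ satisfy $\mathbb P(\|\widehat Z_k-\mu\|\ge r)\le\delta_2$. Then with $\lambda=\lambda(r)$, with probability at least $1-\delta$, $$\|\widehat\mu_n(k)-\mu\|\le 2\Big((\beta\mathfrak C_p(\mathbb B)+K_p2^{p-1})(v+r^p)\Big)^{1/p}\Big(\frac{\beta\log(2/\delta_1)}{n-k}\Big)^{(p-1)/p}.$$ \textbf{(2)} Let $1\le k<n$, let $\widehat Z_k=\frac1k\sum_{m\le k}X_m$ be the empirical mean, and let $\lambda=\lambda(r)$ with $r=2\beta v^{1/p}\delta_2^{-1/p}k^{-(p-1)/p}$.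 Then with probability at least $1-\delta$, $$\|\widehat\mu_n(k)-\mu\|\le 2\beta(vC_p)^{1/p}(1+\varepsilon_k)^{1/p}\Big(\frac{\log(2/\delta_1)}{n-k}\Big)^{(p-1)/p},\qquad(\ast)$$ where $\varepsilon_k=\dfrac{2^p\beta^p}{\delta_2k^{p-1}}=O\Big(\dfrac{\beta^p}{\delta_2k^{p-1}}\Big)$ with an absolute constant; in particular $\varepsilon_k\to0$ as $k\to\infty$. \textbf{(3)} Let $\psi=\frac{11}{18}\log\frac{11/18}{0.9}+\frac7{18}\log\frac{7/18}{0.1}$ and $B=\lfloor\log(1/\delta_2)/\psi\rfloor+1$, let $B\le k<n$, and let $k'=B\lfloor k/B\rfloor$ (so that $k'=k$ if $B$ divides $k$). Let $\widehat Z_k$ be a geometric median-of-means, that is, an $\mathcal F_k$-measurable random variable which almost surely minimizes $z\mapsto\sum_{b=1}^B\|\widehat\mu_b-z\|$ over $\mathbb B$, where $\widehat\mu_b$ is the empirical mean of the $b$-th of the $B$ consecutive blocks of length $\lfloor k/B\rfloor$ of $X_1,\dots,X_{k'}$. Let $\lambda=\lambda(r)$ with $r=\frac{11\beta}{0.1^{1/p}}v^{1/p}\Big(\frac{3.5\log(1/\delta_2)+1}{k'}\Big)^{1-1/p}$.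 Then $(\ast)$ holds with probability at least $1-\delta$, where now $\varepsilon_k=\dfrac{11^p\beta^p}{0.1}\Big(\dfrac{3.5\log(1/\delta_2)+1}{k'}\Big)^{p-1}=O\Big(\beta^p\Big(\dfrac{1+\log(1/\delta_2)}k\Big)^{p-1}\Big)$ with an absolute constant; in particular $\varepsilon_k\to0$ as $k\to\infty$. \textbf{(4)} These bounds are of the order $O\big(\beta v^{1/p}(\log(1/\delta)/n)^{(p-1)/p}\big)$: for every $M$ there is a constant $C$ depending only on $M$ (and on none of $\mathbb B,\beta,p,v,\mu,\delta,\delta_1,\delta_2,k,n$ or the law of the data) such that, if $n\le M(n-k)$ and $\log(2/\delta_1)\le M\log(1/\delta)$, and if $r^p\le Mv$ in case (1), respectively $\varepsilon_k\le M$ in cases (2) and (3), then with probability at least $1-\delta$ $$\|\widehat\mu_n(k)-\mu\|\le C\beta v^{1/p}\Big(\frac{\log(1/\delta)}n\Big)^{(p-1)/p}.$$ -/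

import Mathlib

open MeasureTheory Filter Topology

universe u w

/-- A function `f` on a normed space is `(2, β)`-smooth. -/
structure IsTwoSmooth {E : Type*} [NormedAddCommGroup E] [NormedSpace ℝ E]
    (f : E → ℝ) (β : ℝ) : Prop where
  map_zero : f 0 = 0
  lipschitz : ∀ x y : E, |f (x + y) - f x| ≤ ‖y‖
  smooth : ∀ x y : E, f (x + y) ^ 2 + f (x - y) ^ 2 ≤ 2 * f x ^ 2 + 2 * β ^ 2 * ‖y‖ ^ 2

/-- `(X n)` for `n ≥ 1` is adapted to `ℱ`, has constant conditional mean `μ`, and has conditional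
central `p`-th moments bounded by `v`. (The value `X 0` plays no role. Integrability is recorded
because the conditional expectations are only meaningful under it.) -/
structure IsHeavyTailedSequence {E Ω : Type*} [NormedAddCommGroup E] [NormedSpace ℝ E]
    [CompleteSpace E] {mΩ : MeasurableSpace Ω} (P : Measure Ω) (ℱ : Filtration ℕ mΩ)
    (X : ℕ → Ω → E) (μ : E) (p v : ℝ) : Prop where
  adapted : ∀ n : ℕ, 1 ≤ n → StronglyMeasurable[ℱ n] (X n)
  integrable : ∀ n : ℕ, 1 ≤ n → Integrable (X n) P
  condMean : ∀ n : ℕ, 1 ≤ n → P[X n | ℱ (n - 1)] =ᵐ[P] fun _ => μ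
  integrable_moment : ∀ n : ℕ, 1 ≤ n → Integrable (fun ω => ‖X n ω - μ‖ ^ p) P
  condMoment : ∀ n : ℕ, 1 ≤ n → P[fun ω => ‖X n ω - μ‖ ^ p | ℱ (n - 1)] ≤ᵐ[P] fun _ => v

/-- The norm of `E` is induced by an inner product. -/
def IsHilbertNorm (E : Type*) [NormedAddCommGroup E] [NormedSpace ℝ E] : Prop :=
  ∃ B : LinearMap.BilinForm ℝ E, (∀ x y, B x y = B y x) ∧ ∀ x, B x x = ‖x‖ ^ 2

noncomputable section

/-- The factor `Trunc(x) = min 1 ‖x‖ / ‖x‖`; then `Trunc(a x) x`, for `a > 0`, is the radial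
projection of `x` onto the closed ball of radius `1 / a`. It is only ever used multiplied by its
argument, so its value at `0` is irrelevant. -/
def truncFactor {E : Type*} [NormedAddCommGroup E] (x : E) : ℝ := min 1 ‖x‖ / ‖x‖

/-- The truncated mean of `X (k+1), …, X n`, centred at `Z` and with truncation level `lam`. -/
def truncatedMean {E Ω : Type*} [NormedAddCommGroup E] [NormedSpace ℝ E]
    (X : ℕ → Ω → E) (Z : Ω → E) (lam : ℝ) (k n : ℕ) (ω : Ω) : E :=
  ((n : ℝ) - k)⁻¹ • ∑ m ∈ Finset.Ioc k n,
    (truncFactor (lam • (X m ω - Z ω)) • (X m ω - Z ω) + Z ω)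

open Classical in
/-- The constant `𝔠_p(𝔹, ρ)`. -/
def frakC (E : Type*) [NormedAddCommGroup E] [NormedSpace ℝ E] (p ρ : ℝ) : ℝ :=
  (if IsHilbertNorm E then (2 : ℝ) ^ (p - 1) else (2 : ℝ) ^ (p + 1)) *
    ((Real.exp (2 * ρ) - 2 * ρ - 1) / (2 * ρ) ^ 2)

/-- The constant `K_p = (1 / (p/q + 1)) ((p/q) / (p/q + 1)) ^ (p/q)` with `1/p + 1/q = 1`,
that is, with `p / q = p - 1`. -/
def constK (p : ℝ) : ℝ := 1 / p * ((p - 1) / p) ^ (p - 1)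

/-- `β 𝔠_p(𝔹) + K_p 2^(p-1)`, where `𝔠_p(𝔹) = 𝔠_p(𝔹, 1/β)`. -/
def templateConst (E : Type*) [NormedAddCommGroup E] [NormedSpace ℝ E] (p β : ℝ) : ℝ :=
  β * frakC E p β⁻¹ + constK p * 2 ^ (p - 1)

/-- `C_p = 𝔠_p(𝔹) + β⁻¹ K_p 2^(p-1)`. -/
def leadConst (E : Type*) [NormedAddCommGroup E] [NormedSpace ℝ E] (p β : ℝ) : ℝ :=
  frakC E p β⁻¹ + β⁻¹ * constK p * 2 ^ (p - 1)

/-- The truncation level tuned to the sample size `n`, for an initial estimate that is within `r`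
of the mean with high probability. -/
def optLam (E : Type*) [NormedAddCommGroup E] [NormedSpace ℝ E]
    (p v β δ₁ r : ℝ) (k n : ℕ) : ℝ :=
  (β * Real.log (2 / δ₁) / (((n : ℝ) - k) * (templateConst E p β * (v + r ^ p)))) ^ (1 / p)

/-- The empirical mean of `X 1, …, X k`. -/
def empiricalMean {E Ω : Type*} [NormedAddCommGroup E] [NormedSpace ℝ E]
    (X : ℕ → Ω → E) (k : ℕ) (ω : Ω) : E :=
  (k : ℝ)⁻¹ • ∑ m ∈ Finset.Icc 1 k, X m ω

/-- The concentration radius of the empirical mean of `k` observations. -/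
def meanRadius (p v β δ : ℝ) (k : ℕ) : ℝ :=
  2 * β * v ^ (1 / p) / (δ ^ (1 / p) * (k : ℝ) ^ ((p - 1) / p))

/-- The `o(1)` term (as `k → ∞`) for the empirical mean. -/
def meanErr (p β δ : ℝ) (k : ℕ) : ℝ := 2 ^ p * β ^ p / (δ * (k : ℝ) ^ (p - 1))

/-- `z` is a geometric median of the finite family `y`. -/
def IsGeometricMedian {E ι : Type*} [NormedAddCommGroup E] [Fintype ι] (y : ι → E) (z : E) :
    Prop :=
  ∀ x : E, ∑ b, ‖y b - z‖ ≤ ∑ b, ‖y b - x‖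

/-- The exponent `ψ(α; γ)`. -/
def momPsi (α γ : ℝ) : ℝ :=
  (1 - α) * Real.log ((1 - α) / (1 - γ)) + α * Real.log (α / γ)

/-- The number of blocks `⌊log(1/δ) / ψ(7/18; 0.1)⌋ + 1`. -/
def momBlocks (δ : ℝ) : ℕ := ⌊Real.log (1 / δ) / momPsi (7 / 18) (1 / 10)⌋₊ + 1

/-- The mean of the `b`-th block (`b = 0, 1, …`) when `X 1, X 2, …` is cut into consecutive blocks
of length `N`. -/
def blockMean {E Ω : Type*} [NormedAddCommGroup E] [NormedSpace ℝ E]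
    (X : ℕ → Ω → E) (N b : ℕ) (ω : Ω) : E :=
  (N : ℝ)⁻¹ • ∑ m ∈ Finset.Ioc (b * N) ((b + 1) * N), X m ω

/-- `Z` is a geometric median-of-means of `X 1, …, X k` at confidence level `δ`: a geometric
median of the means of the `momBlocks δ` consecutive blocks of length `⌊k / momBlocks δ⌋`. -/
def IsGeometricMedianOfMeans {E Ω : Type*} [NormedAddCommGroup E] [NormedSpace ℝ E]
    {mΩ : MeasurableSpace Ω} (P : Measure Ω) (X : ℕ → Ω → E) (δ : ℝ) (k : ℕ) (Z : Ω → E) : Prop :=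
  ∀ᵐ ω ∂P, IsGeometricMedian
    (fun b : Fin (momBlocks δ) => blockMean X (k / momBlocks δ) b ω) (Z ω)

/-- The number of observations among the first `k` that the blocks use, i.e. the largest multiple
of the number of blocks which is at most `k`. -/
def momUsed (δ : ℝ) (k : ℕ) : ℕ := momBlocks δ * (k / momBlocks δ)

/-- The concentration radius of the geometric median-of-means. -/
def momRadius (p v β δ : ℝ) (k : ℕ) : ℝ :=
  11 * β / (1 / 10) ^ (1 / p) * v ^ (1 / p) *
    ((3.5 * Real.log (1 / δ) + 1) / momUsed δ k) ^ (1 - 1 / p)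

/-- The `o(1)` term (as `k → ∞`) for the geometric median-of-means. -/
def momErr (p β δ : ℝ) (k : ℕ) : ℝ :=
  11 ^ p * β ^ p / (1 / 10) * ((3.5 * Real.log (1 / δ) + 1) / momUsed δ k) ^ (p - 1)

end

/-! Suppose first that the centre Z lies within r of μ, and write V = v + r^p, N = n - k. A
truncated increment Y is bounded by 1/λ. Its conditional mean misses μ - Z by at most K_p λ^(p-1)
2^(p-1) V (`norm_truncFactor_smul_sub_le`), and its conditional second moment is at most λ^(p-2)
2^(p-1) V. So λ/β times the centred increments are martingale differences of norm at most 2/β. By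
Pinelis' argument the mean of cosh of the norm of their sum grows by a factor of at most 1 + c per
step, with c = `frakC` λ^p V. Markov's inequality bounds the deviation. Together with the bias this
gives the radius β L/(λ N) + T λ^(p-1) V, T being `templateConst`, outside an event of probability 2
exp(-L) (`IsHeavyTailedSequence.measureReal_truncatedMean_le`). The level `optLam` makes both terms
equal. A general Z is first replaced by μ on the ℱ k-event where it is far from μ.

The norm need not be differentiable, so Pinelis' argument is run with finite differences.
`IsTwoSmooth.cosh_norm_add_le` replaces the directional derivative of cosh ‖·‖ by a difference
quotient at scale 2^(-m). For a martingale difference the mean of this quotient is at most of order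
2^(-m), by smoothness and Jensen's inequality (`IsTwoSmooth.integral_cosh_norm_add_le`).

For the initial estimates, smoothness yields a von Bahr–Esseen inequality, and Markov's inequality
then handles the empirical mean. For the median-of-means, each block mean is far from μ with
conditional probability at most 1/10 given the past. A Chernoff bound makes it unlikely that 7/18 of
the blocks are far, and otherwise the geometric median is close to μ (`IsGeometricMedian.card_le`).

The order statement needs T ≤ 11 β, hence β ≥ 1, which smoothness forces on every nontrivial space.
-/

/-! ### Real inequalities for exp, cosh and second differences -/

/-- Termwise comparison of power series: all exponents are at least 2 and x / a ≤ 1. -/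
lemma exp_sub_one_sub_le_sq_mul {x a : ℝ} (hx : 0 ≤ x) (hxa : x ≤ a) (ha : 0 < a) :
    Real.exp x - 1 - x ≤ (x / a) ^ 2 * (Real.exp a - 1 - a) := by
  have key : ∀ y : ℝ, HasSum (fun n : ℕ => y ^ (n + 2) / (n + 2).factorial)
      (Real.exp y - 1 - y) := by
    intro y
    have h := (hasSum_nat_add_iff' 2).2 (NormedSpace.expSeries_div_hasSum_exp (𝔸 := ℝ) y)
    simpa [Finset.sum_range_succ, ← Real.exp_eq_exp_ℝ, sub_sub] using h
  refine hasSum_le (fun n => ?_) (key x) ((key a).mul_left _)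
  rw [← mul_div_assoc]
  gcongr
  have h1 : x ^ (n + 2) = (x / a) ^ (n + 2) * a ^ (n + 2) := by
    rw [div_pow, div_mul_cancel₀ _ (by positivity)]
  rw [h1]
  gcongr ?_ * _
  exact pow_le_pow_of_le_one (by positivity) ((div_le_one ha).2 hxa) (by omega)

lemma exp_sub_one_sub_nonneg (x : ℝ) : 0 ≤ Real.exp x - 1 - x := by
  linarith [Real.add_one_le_exp x]

/-- On [u - ζ, u + ζ] the second derivative of cosh is at most cosh (u + ζ). The difference of the
two sides, as a function of τ = a - u, therefore has a monotone derivative vanishing at τ = 0, and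
its minimum there is 0. -/
lemma cosh_le_taylor {u a ζ : ℝ} (hu : 0 ≤ u) (ha : |a - u| ≤ ζ) :
    Real.cosh a ≤ Real.cosh u + Real.sinh u * (a - u) +
      Real.cosh (u + ζ) * ((a - u) ^ 2 / 2) := by
  have hζ : 0 ≤ ζ := (abs_nonneg _).trans ha
  set k : ℝ → ℝ := fun τ => Real.cosh u + Real.sinh u * τ + Real.cosh (u + ζ) * (τ ^ 2 / 2)
    - Real.cosh (u + τ) with hk
  have hd : ∀ τ, HasDerivAt k (Real.sinh u + Real.cosh (u + ζ) * τ - Real.sinh (u + τ)) τ := by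
    intro τ
    have h1 : HasDerivAt (fun τ : ℝ => Real.cosh (u + τ)) (Real.sinh (u + τ)) τ := by
      simpa using ((hasDerivAt_id τ).const_add u).cosh
    have h2 := ((((hasDerivAt_id τ).const_mul (Real.sinh u)).const_add (Real.cosh u)).add
      ((((hasDerivAt_id τ).pow 2).div_const 2).const_mul (Real.cosh (u + ζ)))).sub h1
    refine h2.congr_deriv ?_
    simp
  have hd2 : ∀ τ, HasDerivAt (fun τ => Real.sinh u + Real.cosh (u + ζ) * τ - Real.sinh (u + τ))
      (Real.cosh (u + ζ) - Real.cosh (u + τ)) τ := by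
    intro τ
    have h1 : HasDerivAt (fun τ : ℝ => Real.sinh (u + τ)) (Real.cosh (u + τ)) τ := by
      simpa using ((hasDerivAt_id τ).const_add u).sinh
    simpa using! (((hasDerivAt_id τ).const_mul (Real.cosh (u + ζ))).const_add (Real.sinh u)).sub h1
  have hmono : MonotoneOn (fun τ => Real.sinh u + Real.cosh (u + ζ) * τ - Real.sinh (u + τ))
      (Set.Icc (-ζ) ζ) := by
    refine monotoneOn_of_hasDerivWithinAt_nonneg (convex_Icc _ _)
      (fun τ _ => (hd2 τ).continuousAt.continuousWithinAt)
      (fun τ _ => (hd2 τ).hasDerivWithinAt) (fun τ hτ => ?_)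
    have hτ := interior_subset hτ
    rw [sub_nonneg, Real.cosh_le_cosh, abs_of_nonneg (by linarith : 0 ≤ u + ζ), abs_le]
    constructor <;> linarith [hτ.1, hτ.2]
  have h0mem : (0 : ℝ) ∈ Set.Icc (-ζ) ζ := ⟨by linarith, hζ⟩
  have hk0 : k 0 = 0 := by simp [hk]
  suffices 0 ≤ k (a - u) by
    simp only [hk] at this
    rw [show u + (a - u) = a by ring] at this
    linarith
  have hmem := abs_le.1 ha
  rw [← hk0]
  rcases le_total 0 (a - u) with h | h
  · refine monotoneOn_of_hasDerivWithinAt_nonneg (convex_Icc 0 ζ)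
      (fun τ _ => (hd τ).continuousAt.continuousWithinAt)
      (fun τ _ => (hd τ).hasDerivWithinAt) (fun τ hτ => ?_) ⟨le_rfl, hζ⟩ ⟨h, hmem.2⟩ h
    have hτ := interior_subset hτ
    simpa using hmono h0mem ⟨by linarith [hτ.1], hτ.2⟩ hτ.1
  · refine antitoneOn_of_hasDerivWithinAt_nonpos (convex_Icc (-ζ) 0)
      (fun τ _ => (hd τ).continuousAt.continuousWithinAt)
      (fun τ _ => (hd τ).hasDerivWithinAt) (fun τ hτ => ?_) ⟨hmem.1, h⟩ ⟨by linarith, le_rfl⟩ h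
    have hτ := interior_subset hτ
    simpa using hmono ⟨hτ.1, by linarith [hτ.2]⟩ h0mem hτ.2

lemma sinh_le_mul_cosh {u : ℝ} (hu : 0 ≤ u) : Real.sinh u ≤ u * Real.cosh u := by
  have hd : ∀ t : ℝ, HasDerivAt (fun t => t * Real.cosh t - Real.sinh t)
      (t * Real.sinh t) t := fun t => by
    have := ((hasDerivAt_id t).mul (Real.hasDerivAt_cosh t)).sub (Real.hasDerivAt_sinh t)
    refine this.congr_deriv ?_
    simp
  have := monotoneOn_of_hasDerivWithinAt_nonneg (convex_Ici (0 : ℝ))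
    (fun τ _ => (hd τ).continuousAt.continuousWithinAt)
    (fun τ _ => (hd τ).hasDerivWithinAt) (fun τ hτ => by
      have hτ : 0 ≤ τ := interior_subset hτ
      exact mul_nonneg hτ (Real.sinh_nonneg_iff.2 hτ)) (Set.self_mem_Ici) (Set.mem_Ici.2 hu) hu
  simp at this
  linarith

lemma cosh_add_le_exp_mul_cosh (u : ℝ) {t : ℝ} (ht : 0 ≤ t) :
    Real.cosh (u + t) ≤ Real.exp t * Real.cosh u := by
  rw [Real.cosh_add, ← Real.cosh_add_sinh t, add_mul]
  have h1 : Real.sinh u ≤ Real.cosh u := (Real.sinh_lt_cosh u).le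
  have h2 : 0 ≤ Real.sinh t := Real.sinh_nonneg_iff.2 ht
  nlinarith

/-- A function whose second differences are of third order lies above its chords at the points
`2 ^ (-m)`. -/
lemma sub_le_two_pow_mul_sub {F : ℝ → ℝ} {K : ℝ}
    (hF : ∀ t s : ℝ, 0 ≤ s → 0 ≤ t - s → t + s ≤ 1 →
      F (t + s) + F (t - s) - 2 * F t ≤ K * s ^ 3) (m : ℕ) :
    F 1 - F 0 ≤ 2 ^ m * (F ((2 ^ m)⁻¹) - F 0) := by
  -- A second difference of step s is a combination, with weights 1, 2, 1, of second differences of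
  -- step s / 2. Each halving thus improves a cubic bound by the factor 4 / 8.
  have h1 : ∀ (m : ℕ) (t s : ℝ), 0 ≤ s → 0 ≤ t - s → t + s ≤ 1 →
      F (t + s) + F (t - s) - 2 * F t ≤ K * s ^ 3 / 2 ^ m := by
    intro m
    induction m with
    | zero => simpa using hF
    | succ m ih =>
      intro t s hs h0 h1
      have e1 := ih (t + s / 2) (s / 2) (by linarith) (by linarith) (by linarith)
      have e2 := ih t (s / 2) (by linarith) (by linarith) (by linarith)
      have e3 := ih (t - s / 2) (s / 2) (by linarith) (by linarith) (by linarith)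
      rw [show t + s / 2 + s / 2 = t + s by ring, show t + s / 2 - s / 2 = t by ring] at e1
      rw [show t - s / 2 + s / 2 = t by ring, show t - s / 2 - s / 2 = t - s by ring] at e3
      have : K * s ^ 3 / 2 ^ (m + 1) = 4 * (K * (s / 2) ^ 3 / 2 ^ m) := by
        rw [pow_succ]; field_simp; ring
      rw [this]
      linarith
  -- In the limit F is midpoint concave on [0, 1].
  have h2 : ∀ t s : ℝ, 0 ≤ s → 0 ≤ t - s → t + s ≤ 1 → F (t + s) + F (t - s) - 2 * F t ≤ 0 := by
    intro t s hs h0 h3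
    refine ge_of_tendsto' (x := atTop) (f := fun m : ℕ => K * s ^ 3 / 2 ^ m) ?_
      (fun m => h1 m t s hs h0 h3)
    have := (tendsto_pow_atTop_nhds_zero_of_lt_one (r := (1 / 2 : ℝ)) (by norm_num)
      (by norm_num)).const_mul (K * s ^ 3)
    simpa [div_eq_mul_inv] using this
  induction m with
  | zero => simp
  | succ m ih =>
    have hle : ((2 : ℝ) ^ m)⁻¹ ≤ 1 := inv_le_one_of_one_le₀ (one_le_pow₀ (by norm_num))
    have hpos : (0 : ℝ) < (2 ^ m)⁻¹ := by positivity
    have e := h2 ((2 ^ m)⁻¹ / 2) ((2 ^ m)⁻¹ / 2) (by linarith) (by linarith) (by linarith)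
    rw [add_halves, sub_self, show ((2 : ℝ) ^ m)⁻¹ / 2 = (2 ^ (m + 1))⁻¹ by
      rw [pow_succ, mul_inv, div_eq_mul_inv]] at e
    have hp : (0 : ℝ) < 2 ^ m := by positivity
    calc F 1 - F 0 ≤ 2 ^ m * (F ((2 ^ m)⁻¹) - F 0) := ih
      _ ≤ 2 ^ m * (2 * (F ((2 ^ (m + 1))⁻¹) - F 0)) := by gcongr; linarith
      _ = _ := by ring

/-! ### Consequences of smoothness for cosh ‖·‖ and ‖·‖ ^ p -/

namespace IsTwoSmooth

variable {E : Type*} [NormedAddCommGroup E] [NormedSpace ℝ E] {β : ℝ}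

/-- With u = ‖y‖ and a, b = ‖y ± z‖, Taylor's bound leaves the first-order term sinh u (a + b - 2u).
Smoothness bounds (a - u)² + (b - u)² by 2β²‖z‖² - 2u(a + b - 2u). Since a + b ≥ 2u and sinh u ≤ u
cosh (u + ‖z‖), the negative part absorbs the first-order term. -/
lemma cosh_norm_second_difference_le (h : IsTwoSmooth (fun x : E => ‖x‖) β) (y z : E) :
    Real.cosh ‖y + z‖ + Real.cosh ‖y - z‖ - 2 * Real.cosh ‖y‖ ≤
      β ^ 2 * ‖z‖ ^ 2 * Real.exp ‖z‖ * Real.cosh ‖y‖ := by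
  have hs : ‖y + z‖ ^ 2 + ‖y - z‖ ^ 2 ≤ 2 * ‖y‖ ^ 2 + 2 * β ^ 2 * ‖z‖ ^ 2 := h.smooth y z
  have ha : |‖y + z‖ - ‖y‖| ≤ ‖z‖ := by simpa using abs_norm_sub_norm_le (y + z) y
  have hb : |‖y - z‖ - ‖y‖| ≤ ‖z‖ := by simpa using abs_norm_sub_norm_le (y - z) y
  have h1 := cosh_le_taylor (norm_nonneg y) ha
  have h2 := cosh_le_taylor (norm_nonneg y) hb
  have h3 : 0 ≤ ‖y + z‖ + ‖y - z‖ - 2 * ‖y‖ := by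
    have := norm_add_le (y + z) (y - z)
    rw [show y + z + (y - z) = (2 : ℝ) • y by rw [two_smul]; abel, norm_smul] at this
    simp at this
    linarith
  have h4 := cosh_add_le_exp_mul_cosh ‖y‖ (norm_nonneg z)
  have h5 : Real.sinh ‖y‖ ≤ ‖y‖ * Real.cosh (‖y‖ + ‖z‖) := by
    refine (sinh_le_mul_cosh (norm_nonneg y)).trans ?_
    gcongr
    rw [Real.cosh_le_cosh, abs_of_nonneg (norm_nonneg _), abs_of_nonneg (by positivity)]
    linarith [norm_nonneg z]
  set a := ‖y + z‖
  set b := ‖y - z‖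
  set u := ‖y‖
  set c := Real.cosh (u + ‖z‖)
  have hc : 0 < c := Real.cosh_pos _
  have h6 : (a - u) ^ 2 + (b - u) ^ 2 ≤ 2 * β ^ 2 * ‖z‖ ^ 2 - 2 * u * (a + b - 2 * u) := by
    nlinarith
  calc _ ≤ Real.sinh u * (a + b - 2 * u) + c * (((a - u) ^ 2 + (b - u) ^ 2) / 2) := by linarith
    _ ≤ u * c * (a + b - 2 * u) +
        c * ((2 * β ^ 2 * ‖z‖ ^ 2 - 2 * u * (a + b - 2 * u)) / 2) := by gcongr
    _ = β ^ 2 * ‖z‖ ^ 2 * c := by ring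
    _ ≤ β ^ 2 * ‖z‖ ^ 2 * (Real.exp ‖z‖ * Real.cosh u) := by gcongr
    _ = _ := by ring

/-- Subtracting β² cosh ‖x‖ (exp (t‖d‖) - 1 - t‖d‖) from cosh ‖x + t d‖ cancels the second-order
growth in t, so the second differences become cubic and `sub_le_two_pow_mul_sub` applies. The last
summand stands in for the derivative of cosh ‖·‖ at x along d. -/
lemma cosh_norm_add_le (h : IsTwoSmooth (fun x : E => ‖x‖) β) (x d : E) (m : ℕ) :
    Real.cosh ‖x + d‖ ≤ Real.cosh ‖x‖ * (1 + β ^ 2 * (Real.exp ‖d‖ - 1 - ‖d‖)) +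
      2 ^ m * (Real.cosh ‖x + ((2 : ℝ) ^ m)⁻¹ • d‖ - Real.cosh ‖x‖) := by
  set D := ‖d‖
  have hD : 0 ≤ D := norm_nonneg d
  set H := Real.cosh ‖x‖
  have hH : 0 < H := Real.cosh_pos _
  have key := sub_le_two_pow_mul_sub (K := β ^ 2 * H * D ^ 3 * Real.exp (3 * D)) (m := m)
    (F := fun t => Real.cosh ‖x + t • d‖ - β ^ 2 * H * (Real.exp (t * D) - 1 - t * D)) ?_
  · simp only [one_smul, one_mul, zero_smul, add_zero, zero_mul, Real.exp_zero, sub_self,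
      sub_zero, mul_zero] at key
    have h2 : 0 ≤ β ^ 2 * H * (Real.exp ((2 ^ m)⁻¹ * D) - 1 - (2 ^ m)⁻¹ * D) :=
      mul_nonneg (by positivity) (exp_sub_one_sub_nonneg _)
    have h3 : (2 : ℝ) ^ m * (Real.cosh ‖x + ((2 : ℝ) ^ m)⁻¹ • d‖ -
        β ^ 2 * H * (Real.exp ((2 ^ m)⁻¹ * D) - 1 - (2 ^ m)⁻¹ * D) - H) ≤
        2 ^ m * (Real.cosh ‖x + ((2 : ℝ) ^ m)⁻¹ • d‖ - H) := by
      gcongr; linarith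
    linarith
  · intro t s hs h0 h1
    have e := h.cosh_norm_second_difference_le (x + t • d) (s • d)
    rw [norm_smul, Real.norm_of_nonneg hs, show x + t • d + s • d = x + (t + s) • d by
      rw [add_smul]; abel, show x + t • d - s • d = x + (t - s) • d by rw [sub_smul]; abel] at e
    have e1 : Real.cosh ‖x + t • d‖ ≤ Real.exp (t * D) * H := by
      refine le_trans ?_ (cosh_add_le_exp_mul_cosh ‖x‖ (by nlinarith))
      rw [Real.cosh_le_cosh, abs_norm, abs_of_nonneg (by
        have := norm_nonneg x
        nlinarith)]
      refine (norm_add_le _ _).trans ?_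
      rw [norm_smul, Real.norm_of_nonneg (by linarith)]
    have e2 : Real.exp ((t + s) * D) + Real.exp ((t - s) * D) - 2 * Real.exp (t * D) ≥
        Real.exp (t * D) * (s * D) ^ 2 := by
      have e3 : 1 + (s * D) ^ 2 / 2 ≤ Real.cosh (s * D) := by
        have h0 := sum_le_hasSum (Finset.range 2) (fun n _ => div_nonneg
          ((even_two_mul n).pow_nonneg (s * D)) (Nat.cast_nonneg _)) (Real.hasSum_cosh (s * D))
        simpa [Finset.sum_range_succ] using h0
      rw [show (t + s) * D = t * D + s * D by ring, show (t - s) * D = t * D + -(s * D) by ring,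
        Real.exp_add, Real.exp_add]
      rw [Real.cosh_eq] at e3
      nlinarith [Real.exp_pos (t * D)]
    have e4 : Real.exp (s * D) - 1 ≤ s * D * Real.exp (s * D) := by
      have h5 := Real.add_one_le_exp (-(s * D))
      have h6 : Real.exp (-(s * D)) * Real.exp (s * D) = 1 := by
        rw [← Real.exp_add]; simp
      nlinarith [Real.exp_pos (s * D)]
    have e5 : Real.exp (t * D) * Real.exp (s * D) ≤ Real.exp (3 * D) := by
      rw [← Real.exp_add]; gcongr; nlinarith
    have hβH : 0 ≤ β ^ 2 * H := by positivity
    calc _ = (Real.cosh ‖x + (t + s) • d‖ + Real.cosh ‖x + (t - s) • d‖ -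
          2 * Real.cosh ‖x + t • d‖) - β ^ 2 * H * (Real.exp ((t + s) * D) +
            Real.exp ((t - s) * D) - 2 * Real.exp (t * D)) := by ring
      _ ≤ β ^ 2 * (s * D) ^ 2 * Real.exp (s * D) * (Real.exp (t * D) * H) -
          β ^ 2 * H * (Real.exp (t * D) * (s * D) ^ 2) := by
        refine sub_le_sub (e.trans ?_) ?_
        · gcongr
        · gcongr
      _ = β ^ 2 * H * (s * D) ^ 2 * Real.exp (t * D) * (Real.exp (s * D) - 1) := by ring
      _ ≤ β ^ 2 * H * (s * D) ^ 2 * Real.exp (t * D) * (s * D * Real.exp (s * D)) := by gcongr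
      _ = β ^ 2 * H * D ^ 3 * s ^ 3 * (Real.exp (t * D) * Real.exp (s * D)) := by ring
      _ ≤ β ^ 2 * H * D ^ 3 * s ^ 3 * Real.exp (3 * D) := by gcongr
      _ = _ := by ring

/-- The power p / 2 ≤ 1 is concave on the left side of the smoothness inequality and subadditive on
the right. -/
lemma rpow_norm_add_add_rpow_norm_sub_le (h : IsTwoSmooth (fun x : E => ‖x‖) β) (hβ : 0 < β)
    {p : ℝ} (hp : 1 < p) (hp2 : p ≤ 2) (x y : E) :
    ‖x + y‖ ^ p + ‖x - y‖ ^ p ≤ 2 * ‖x‖ ^ p + 2 * β ^ p * ‖y‖ ^ p := by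
  have hs : ‖x + y‖ ^ 2 + ‖x - y‖ ^ 2 ≤ 2 * ‖x‖ ^ 2 + 2 * β ^ 2 * ‖y‖ ^ 2 := h.smooth x y
  have hq0 : 0 ≤ p / 2 := by linarith
  have hq1 : p / 2 ≤ 1 := by linarith
  have hsq : ∀ a : ℝ, 0 ≤ a → (a ^ 2) ^ (p / 2) = a ^ p := fun a ha => by
    rw [← Real.rpow_natCast a 2, ← Real.rpow_mul ha]; congr 1; push_cast; ring
  have hc := (Real.concaveOn_rpow hq0 hq1).2 (Set.mem_Ici.2 (sq_nonneg ‖x + y‖))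
    (Set.mem_Ici.2 (sq_nonneg ‖x - y‖)) (show (0 : ℝ) ≤ 1 / 2 by norm_num)
    (show (0 : ℝ) ≤ 1 / 2 by norm_num) (by norm_num)
  simp only [smul_eq_mul] at hc
  rw [hsq _ (norm_nonneg _), hsq _ (norm_nonneg _)] at hc
  have h1 : (1 / 2 * ‖x + y‖ ^ 2 + 1 / 2 * ‖x - y‖ ^ 2) ^ (p / 2) ≤
      (‖x‖ ^ 2 + (β * ‖y‖) ^ 2) ^ (p / 2) := by
    apply Real.rpow_le_rpow (by positivity) _ hq0
    rw [mul_pow]; linarith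
  have h2 := Real.rpow_add_le_add_rpow (sq_nonneg ‖x‖) (sq_nonneg (β * ‖y‖)) hq0 hq1
  rw [hsq _ (norm_nonneg _), hsq _ (by positivity), Real.mul_rpow hβ.le (norm_nonneg _)] at h2
  linarith

lemma one_le (h : IsTwoSmooth (fun x : E => ‖x‖) β) (hβ : 0 < β) [Nontrivial E] : 1 ≤ β := by
  obtain ⟨y, hy⟩ := exists_ne (0 : E)
  have hs := h.smooth 0 y
  simp only [zero_add, zero_sub, norm_neg, norm_zero] at hs
  have : 0 < ‖y‖ ^ 2 := by positivity
  have h1 : 1 ≤ β ^ 2 := by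
    by_contra! hlt
    nlinarith
  nlinarith

end IsTwoSmooth

/-! ### Truncation and its bias -/

lemma constK_pos {p : ℝ} (hp : 1 < p) : 0 < constK p := by
  have : 0 < (p - 1) / p := div_pos (by linarith) (by linarith)
  unfold constK
  positivity

/-- The constant is optimal: the right side touches the identity at s₀ = p / (p - 1), and
Bernoulli's inequality at s / s₀ is the tangent-line bound there. -/
lemma le_one_add_constK_mul_rpow {p s : ℝ} (hp : 1 < p) (hs : 0 ≤ s) :
    s ≤ 1 + constK p * s ^ p := by
  have hp0 : 0 < p := by linarith
  have hp1 : 0 < p - 1 := by linarith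
  set s₀ := p / (p - 1) with hs₀
  have hs₀p : 0 < s₀ := div_pos hp0 hp1
  have hK : constK p * s₀ ^ p = 1 / (p - 1) := by
    have h1 : ((p - 1) / p) ^ (p - 1) = (s₀ ^ (p - 1))⁻¹ := by
      rw [hs₀, ← Real.inv_rpow hs₀p.le, inv_div]
    have h2 : s₀ ^ p = s₀ ^ (p - 1) * s₀ := by
      rw [← Real.rpow_add_one hs₀p.ne']; congr 1; ring
    have h3 : s₀ ^ (p - 1) ≠ 0 := (Real.rpow_pos_of_pos hs₀p _).ne'
    rw [constK, h1, h2, hs₀]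
    rw [hs₀] at h3
    field_simp
  have hb := one_add_mul_self_le_rpow_one_add (s := s / s₀ - 1) (p := p)
    (by have : 0 ≤ s / s₀ := by positivity
        linarith) hp.le
  rw [add_sub_cancel] at hb
  have h4 : constK p * s ^ p = 1 / (p - 1) * (s / s₀) ^ p := by
    rw [← hK, Real.div_rpow hs hs₀p.le]
    have := (Real.rpow_pos_of_pos hs₀p p).ne'
    field_simp
  rw [h4]
  have h5 : 1 / (p - 1) * (1 + p * (s / s₀ - 1)) ≤ 1 / (p - 1) * (s / s₀) ^ p := by gcongr
  have h6 : 1 + 1 / (p - 1) * (1 + p * (s / s₀ - 1)) = s := by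
    rw [hs₀]; field_simp; ring
  linarith

lemma truncFactor_nonneg {E : Type*} [NormedAddCommGroup E] (x : E) : 0 ≤ truncFactor x := by
  unfold truncFactor; positivity

lemma truncFactor_le_one {E : Type*} [NormedAddCommGroup E] (x : E) : truncFactor x ≤ 1 :=
  div_le_one_of_le₀ (min_le_right _ _) (norm_nonneg _)

section Truncation

variable {E : Type*} [NormedAddCommGroup E] [NormedSpace ℝ E] {lam : ℝ}

lemma norm_truncFactor_smul_le_norm (x : E) : ‖truncFactor (lam • x) • x‖ ≤ ‖x‖ := by
  rw [norm_smul, Real.norm_of_nonneg (truncFactor_nonneg _)]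
  exact mul_le_of_le_one_left (norm_nonneg _) (truncFactor_le_one _)

lemma norm_truncFactor_smul_le (hl : 0 < lam) (x : E) :
    ‖truncFactor (lam • x) • x‖ ≤ lam⁻¹ := by
  rw [norm_smul, Real.norm_of_nonneg (truncFactor_nonneg _), truncFactor, norm_smul,
    Real.norm_of_nonneg hl.le]
  rcases eq_or_ne x 0 with rfl | hx
  · simp [hl.le]
  · have hx : 0 < ‖x‖ := norm_pos_iff.2 hx
    calc min 1 (lam * ‖x‖) / (lam * ‖x‖) * ‖x‖ = min 1 (lam * ‖x‖) * lam⁻¹ := by field_simp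
      _ ≤ 1 * lam⁻¹ := by gcongr; exact min_le_left _ _
      _ = _ := one_mul _

/-- There is an error only when lam * ‖x‖ > 1; it is then ‖x‖ - 1 / lam, and
`le_one_add_constK_mul_rpow` at s = lam * ‖x‖ bounds it. -/
lemma norm_truncFactor_smul_sub_le {p : ℝ} (hp : 1 < p) (hl : 0 < lam) (x : E) :
    ‖truncFactor (lam • x) • x - x‖ ≤ constK p * lam ^ (p - 1) * ‖x‖ ^ p := by
  have hK := (constK_pos hp).le
  have h1 : ‖truncFactor (lam • x) • x - x‖ = (1 - truncFactor (lam • x)) * ‖x‖ := by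
    rw [← norm_neg, neg_sub, ← norm_smul_of_nonneg (sub_nonneg.2 (truncFactor_le_one _)),
      sub_smul, one_smul]
  have h0 : 0 ≤ constK p * lam ^ (p - 1) * ‖x‖ ^ p := by positivity
  rw [h1, truncFactor, norm_smul, Real.norm_of_nonneg hl.le]
  rcases eq_or_ne x 0 with rfl | hx
  · simpa using h0
  have hx : 0 < ‖x‖ := norm_pos_iff.2 hx
  rcases le_total (lam * ‖x‖) 1 with h | h
  · rw [min_eq_right h, div_self (by positivity)]
    simpa using h0
  · rw [min_eq_left h]
    have h2 := le_one_add_constK_mul_rpow hp (s := lam * ‖x‖) (by positivity)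
    rw [Real.mul_rpow hl.le hx.le] at h2
    have h3 : lam ^ p = lam ^ (p - 1) * lam := by
      rw [← Real.rpow_add_one hl.ne']; congr 1; ring
    rw [h3] at h2
    refine le_of_mul_le_mul_left ?_ hl
    have : lam * ((1 - 1 / (lam * ‖x‖)) * ‖x‖) = lam * ‖x‖ - 1 := by field_simp
    rw [this]
    linarith

end Truncation

/-! ### Geometric medians and the exponent ψ -/

/-- This is the source of the factor 3.5 = 7 / 2 in the bound on the number of blocks. -/
lemma two_div_seven_le_momPsi : 2 / 7 ≤ momPsi (7 / 18) (1 / 10) := by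
  -- The claim multiplied by 126 = 7 * 18, which turns all coefficients into integers.
  have h : (36 : ℝ) ≤ Real.log (((55 / 81) ^ 11 * (35 / 9) ^ 7) ^ 7) := by
    rw [Real.le_log_iff_exp_le (by positivity)]
    calc Real.exp 36 = Real.exp 1 ^ 36 := by rw [← Real.exp_nat_mul]; norm_num
      _ ≤ 2.7182818286 ^ 36 := by gcongr; exact Real.exp_one_lt_d9.le
      _ ≤ _ := by norm_num
  rw [Real.log_pow, Real.log_mul (by positivity) (by positivity), Real.log_pow, Real.log_pow] at h
  rw [momPsi]
  norm_num at h ⊢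
  linarith

/-- Put D = ‖z - x‖. A point within s of x is farther from z than from x by at least D - 2s; any
other point is nearer to z by at most D. Minimality at z then forces n(D - 2s) ≤ (2D - 2s) · #far,
and at D = 11s/2 the ratio (D - 2s)/(2D - 2s) equals 7/18. -/
lemma IsGeometricMedian.card_le {E ι : Type*} [NormedAddCommGroup E] [Fintype ι]
    {y : ι → E} {z : E} (h : IsGeometricMedian y z) {x : E} {s : ℝ} (hs : 0 < s)
    (hz : 11 / 2 * s ≤ ‖z - x‖) :
    (7 / 18 : ℝ) * Fintype.card ι ≤ ∑ b, Set.indicator {b | s ≤ ‖y b - x‖} 1 b := by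
  classical
  set D := ‖z - x‖
  have hx := h x
  have key : ∀ b, (D - 2 * s) - (2 * D - 2 * s) * Set.indicator {b | s ≤ ‖y b - x‖} 1 b ≤
      ‖y b - z‖ - ‖y b - x‖ := by
    intro b
    have h1 : D ≤ ‖y b - z‖ + ‖y b - x‖ := by
      have := norm_sub_le (y b - x) (y b - z)
      rw [sub_sub_sub_cancel_left] at this
      linarith
    have h2 : ‖y b - x‖ ≤ ‖y b - z‖ + D := by
      have := norm_add_le (y b - z) (z - x)
      rwa [sub_add_sub_cancel] at this
    by_cases hb : s ≤ ‖y b - x‖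
    · rw [Set.indicator_of_mem (by exact hb)]
      simp only [Pi.one_apply]
      linarith
    · rw [Set.indicator_of_notMem (by exact hb)]
      push Not at hb
      linarith
  have hsum := Finset.sum_le_sum (fun b (_ : b ∈ Finset.univ) => key b)
  simp only [Finset.sum_sub_distrib, ← Finset.mul_sum, Finset.sum_const, nsmul_eq_mul,
    Finset.card_univ] at hsum
  set T := ∑ b, Set.indicator {b | s ≤ ‖y b - x‖} (1 : ι → ℝ) b
  have h3 : (Fintype.card ι : ℝ) * (D - 2 * s) ≤ (2 * D - 2 * s) * T := by linarith
  by_contra! hlt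
  have hn : (0 : ℝ) ≤ Fintype.card ι := by positivity
  have h4 : (2 * D - 2 * s) * T < (2 * D - 2 * s) * (7 / 18 * Fintype.card ι) := by
    apply mul_lt_mul_of_pos_left hlt; linarith
  nlinarith [mul_nonneg hn (show 0 ≤ D - 11 / 2 * s by linarith)]

/-! ### Martingale inequalities in a smooth Banach space -/

lemma convexOn_cosh_norm {E : Type*} [NormedAddCommGroup E] [NormedSpace ℝ E] :
    ConvexOn ℝ Set.univ (fun x : E => Real.cosh ‖x‖) := by
  have h1 : ConvexOn ℝ Set.univ Real.cosh := by
    refine Monotone.convexOn_univ_of_deriv Real.differentiable_cosh ?_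
    rw [Real.deriv_cosh]
    exact Real.sinh_strictMono.monotone
  refine ⟨convex_univ, fun x _ y _ a b ha hb hab => ?_⟩
  refine le_trans ?_ (h1.2 (Set.mem_univ ‖x‖) (Set.mem_univ ‖y‖) ha hb hab)
  rw [Real.cosh_le_cosh, abs_norm]
  exact (convexOn_univ_norm.2 (Set.mem_univ x) (Set.mem_univ y) ha hb hab).trans (le_abs_self _)

lemma convexOn_norm_rpow {E : Type*} [NormedAddCommGroup E] [NormedSpace ℝ E] {p : ℝ}
    (hp : 1 ≤ p) : ConvexOn ℝ Set.univ (fun x : E => ‖x‖ ^ p) := by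
  refine ⟨convex_univ, fun x _ y _ a b ha hb hab => ?_⟩
  refine (Real.rpow_le_rpow (norm_nonneg _)
    (convexOn_univ_norm.2 (Set.mem_univ x) (Set.mem_univ y) ha hb hab) (by linarith)).trans ?_
  exact (convexOn_rpow hp).2 (norm_nonneg x) (norm_nonneg y) ha hb hab

section Martingale

variable {E Ω : Type*} [NormedAddCommGroup E] [NormedSpace ℝ E] [CompleteSpace E]
  {m mΩ : MeasurableSpace Ω} {P : Measure Ω} [IsProbabilityMeasure P] {β : ℝ}

/-- Conditional Jensen, because S is the conditional expectation of S - d. -/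
lemma ConvexOn.integral_le_integral_sub {φ : E → ℝ} (hφ : ConvexOn ℝ Set.univ φ)
    (hφc : Continuous φ) (hm : m ≤ mΩ) {S d : Ω → E}
    (hS : StronglyMeasurable[m] S) (hSi : Integrable S P) (hd : Integrable d P)
    (hd0 : P[d | m] =ᵐ[P] 0) (hφS : Integrable (fun ω => φ (S ω)) P)
    (hφd : Integrable (fun ω => φ (S ω - d ω)) P) :
    ∫ ω, φ (S ω) ∂P ≤ ∫ ω, φ (S ω - d ω) ∂P := by
  have h1 := hφ.map_condExp_le_univ hm hφc.lowerSemicontinuous (hSi.sub hd) hφd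
  have h2 := condExp_sub hSi hd m
  rw [← integral_condExp hm (f := fun ω => φ (S ω - d ω))]
  refine integral_mono_ae hφS integrable_condExp ?_
  filter_upwards [h1, h2, hd0] with ω h1 h2 h3
  rw [Function.comp_apply, h2, Pi.sub_apply, h3, condExp_of_stronglyMeasurable hm hS hSi] at h1
  simpa [Function.comp_def] using h1

/-- In `cosh_norm_add_le` the first summand integrates to the factor 1 + c, as cosh ‖S‖ is
m-measurable. The other is small: by smoothness, the increment of cosh ‖·‖ from S to S + t d exceeds
the one from S - t d to S by at most K t², and the latter has nonpositive mean by Jensen. With t =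
2^(-j), multiplication by 2^j leaves K 2^(-j). -/
lemma IsTwoSmooth.integral_cosh_norm_add_le (h : IsTwoSmooth (fun x : E => ‖x‖) β)
    (hm : m ≤ mΩ) {S d : Ω → E} (hS : StronglyMeasurable[m] S)
    (hd : AEStronglyMeasurable d P) (hd0 : P[d | m] =ᵐ[P] 0) {A b c : ℝ}
    (hSA : ∀ᵐ ω ∂P, ‖S ω‖ ≤ A) (hdb : ∀ᵐ ω ∂P, ‖d ω‖ ≤ b)
    (hc : ∀ᵐ ω ∂P, β ^ 2 * P[fun ω => Real.exp ‖d ω‖ - 1 - ‖d ω‖ | m] ω ≤ c) :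
    ∫ ω, Real.cosh ‖S ω + d ω‖ ∂P ≤ (1 + c) * ∫ ω, Real.cosh ‖S ω‖ ∂P := by
  have hSm : AEStronglyMeasurable S P := (hS.mono hm).aestronglyMeasurable
  have hSi : Integrable S P := Integrable.of_bound hSm A hSA
  have hdi : Integrable d P := Integrable.of_bound hd b hdb
  have hcosh : ∀ t : ℝ, |t| ≤ 1 → Integrable (fun ω => Real.cosh ‖S ω + t • d ω‖) P := by
    intro t ht
    refine Integrable.of_bound (by fun_prop) (Real.cosh (A + b)) ?_
    filter_upwards [hSA, hdb] with ω h1 h2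
    rw [Real.norm_of_nonneg (Real.cosh_pos _).le, Real.cosh_le_cosh, abs_norm]
    refine ((norm_add_le _ _).trans ?_).trans (le_abs_self _)
    rw [norm_smul]
    have : ‖t‖ * ‖d ω‖ ≤ 1 * ‖d ω‖ := by gcongr; exact ht
    linarith
  have hcS : Integrable (fun ω => Real.cosh ‖S ω‖) P := by simpa using hcosh 0 (by simp)
  have he : Integrable (fun ω => Real.exp ‖d ω‖ - 1 - ‖d ω‖) P := by
    refine Integrable.of_bound (by fun_prop) (Real.exp b) ?_
    filter_upwards [hdb] with ω h2
    rw [Real.norm_of_nonneg (exp_sub_one_sub_nonneg _)]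
    have := Real.exp_le_exp.2 h2
    linarith [norm_nonneg (d ω)]
  have hce : Integrable (fun ω => Real.cosh ‖S ω‖ * (Real.exp ‖d ω‖ - 1 - ‖d ω‖)) P := by
    refine he.bdd_mul (c := Real.cosh A) (by fun_prop) ?_
    filter_upwards [hSA] with ω h1
    rw [Real.norm_of_nonneg (Real.cosh_pos _).le, Real.cosh_le_cosh, abs_norm]
    exact h1.trans (le_abs_self _)
  have hmain : ∫ ω, Real.cosh ‖S ω‖ * (1 + β ^ 2 * (Real.exp ‖d ω‖ - 1 - ‖d ω‖)) ∂P ≤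
      (1 + c) * ∫ ω, Real.cosh ‖S ω‖ ∂P := by
    have hcSm : StronglyMeasurable[m] (fun ω => Real.cosh ‖S ω‖) :=
      Real.continuous_cosh.comp_stronglyMeasurable hS.norm
    have hpull := condExp_mul_of_stronglyMeasurable_left hcSm hce he
    have h1 : ∫ ω, Real.cosh ‖S ω‖ * (Real.exp ‖d ω‖ - 1 - ‖d ω‖) ∂P =
        ∫ ω, Real.cosh ‖S ω‖ * P[fun ω => Real.exp ‖d ω‖ - 1 - ‖d ω‖ | m] ω ∂P := by
      rw [← integral_condExp hm]
      exact integral_congr_ae hpull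
    have h2 : ∫ ω, β ^ 2 * (Real.cosh ‖S ω‖ * P[fun ω => Real.exp ‖d ω‖ - 1 - ‖d ω‖ | m] ω) ∂P ≤
        ∫ ω, c * Real.cosh ‖S ω‖ ∂P := by
      refine integral_mono_ae ((integrable_condExp.congr hpull).const_mul _) (hcS.const_mul _) ?_
      filter_upwards [hc] with ω h1
      have := mul_le_mul_of_nonneg_left h1 (Real.cosh_pos ‖S ω‖).le
      linarith
    rw [integral_const_mul, ← h1, integral_const_mul] at h2
    have h3 : ∫ ω, Real.cosh ‖S ω‖ * (1 + β ^ 2 * (Real.exp ‖d ω‖ - 1 - ‖d ω‖)) ∂P =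
        ∫ ω, Real.cosh ‖S ω‖ ∂P +
          β ^ 2 * ∫ ω, Real.cosh ‖S ω‖ * (Real.exp ‖d ω‖ - 1 - ‖d ω‖) ∂P := by
      rw [← integral_const_mul, ← integral_add hcS (hce.const_mul _)]
      congr 1; ext ω; ring
    rw [h3]; linarith
  have hme : Integrable
      (fun ω => Real.cosh ‖S ω‖ * (1 + β ^ 2 * (Real.exp ‖d ω‖ - 1 - ‖d ω‖))) P := by
    refine (hcS.add (hce.const_mul (β ^ 2))).congr (Eventually.of_forall fun ω => ?_)
    simp only [Pi.add_apply]; ring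
  set K : ℝ := β ^ 2 * b ^ 2 * Real.exp b * Real.cosh A with hK
  have hstep : ∀ j : ℕ, ∫ ω, Real.cosh ‖S ω + d ω‖ ∂P ≤
      (1 + c) * ∫ ω, Real.cosh ‖S ω‖ ∂P + K * (2 ^ j)⁻¹ := by
    intro j
    set t : ℝ := (2 ^ j)⁻¹ with ht
    have ht0 : 0 < t := by positivity
    have ht1 : t ≤ 1 := inv_le_one_of_one_le₀ (one_le_pow₀ (by norm_num))
    have hi := hcosh t (by rwa [abs_of_pos ht0])
    have hi' : Integrable (fun ω => Real.cosh ‖S ω - t • d ω‖) P := by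
      simpa [sub_eq_add_neg] using hcosh (-t) (by rwa [abs_neg, abs_of_pos ht0])
    have hJ := convexOn_cosh_norm.integral_le_integral_sub (by fun_prop) hm hS hSi
      (hdi.smul t) (by
        filter_upwards [condExp_smul t d m, hd0] with ω h1 h2
        rw [h1, Pi.smul_apply, h2]; simp) hcS hi'
    simp only [Pi.smul_apply] at hJ
    have hsub : Integrable (fun ω => Real.cosh ‖S ω + t • d ω‖ - Real.cosh ‖S ω‖) P := hi.sub hcS
    have hsub' : Integrable (fun ω => Real.cosh ‖S ω‖ - Real.cosh ‖S ω - t • d ω‖) P :=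
      hcS.sub hi'
    have h1 : ∫ ω, (Real.cosh ‖S ω + t • d ω‖ - Real.cosh ‖S ω‖) ∂P ≤ K * t ^ 2 := by
      have h2 : ∫ ω, (Real.cosh ‖S ω + t • d ω‖ - Real.cosh ‖S ω‖) ∂P ≤
          ∫ ω, ((Real.cosh ‖S ω‖ - Real.cosh ‖S ω - t • d ω‖) + K * t ^ 2) ∂P := by
        refine integral_mono_ae hsub (hsub'.add (integrable_const _)) ?_
        filter_upwards [hSA, hdb] with ω h3 h4
        have h5 := h.cosh_norm_second_difference_le (S ω) (t • d ω)
        have h6 : ‖t • d ω‖ ≤ t * b := by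
          rw [norm_smul, Real.norm_of_nonneg ht0.le]; gcongr
        have hb : 0 ≤ b := (norm_nonneg _).trans h4
        have h7 : β ^ 2 * ‖t • d ω‖ ^ 2 * Real.exp ‖t • d ω‖ * Real.cosh ‖S ω‖ ≤
            β ^ 2 * (t * b) ^ 2 * Real.exp b * Real.cosh A := by
          gcongr
          · exact h6.trans (mul_le_of_le_one_left hb ht1)
          · rw [Real.cosh_le_cosh, abs_norm]; exact h3.trans (le_abs_self _)
        have h8 : β ^ 2 * (t * b) ^ 2 * Real.exp b * Real.cosh A = K * t ^ 2 := by
          rw [hK]; ring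
        linarith
      rw [integral_add hsub' (integrable_const _), integral_sub hcS hi'] at h2
      simp only [integral_const, probReal_univ, one_smul] at h2
      linarith
    calc ∫ ω, Real.cosh ‖S ω + d ω‖ ∂P
        ≤ ∫ ω, (Real.cosh ‖S ω‖ * (1 + β ^ 2 * (Real.exp ‖d ω‖ - 1 - ‖d ω‖)) +
          2 ^ j * (Real.cosh ‖S ω + t • d ω‖ - Real.cosh ‖S ω‖)) ∂P := by
          refine integral_mono (by simpa using hcosh 1 (by simp))
            (hme.add (hsub.const_mul _)) fun ω => ?_
          exact h.cosh_norm_add_le (S ω) (d ω) j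
      _ = ∫ ω, Real.cosh ‖S ω‖ * (1 + β ^ 2 * (Real.exp ‖d ω‖ - 1 - ‖d ω‖)) ∂P +
          2 ^ j * ∫ ω, (Real.cosh ‖S ω + t • d ω‖ - Real.cosh ‖S ω‖) ∂P := by
          rw [integral_add hme (hsub.const_mul _), integral_const_mul]
      _ ≤ (1 + c) * ∫ ω, Real.cosh ‖S ω‖ ∂P + 2 ^ j * (K * t ^ 2) := by gcongr
      _ = _ := by rw [ht]; field_simp
  refine ge_of_tendsto' (x := atTop) (f := fun j : ℕ =>
    (1 + c) * ∫ ω, Real.cosh ‖S ω‖ ∂P + K * (2 ^ j)⁻¹) ?_ hstep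
  have := ((tendsto_pow_atTop_nhds_zero_of_lt_one (r := (1 / 2 : ℝ)) (by norm_num)
    (by norm_num)).const_mul K).const_add ((1 + c) * ∫ ω, Real.cosh ‖S ω‖ ∂P)
  simpa using this

/-- Pinelis' inequality for sums of bounded martingale differences. -/
lemma IsTwoSmooth.integral_cosh_norm_sum_le (h : IsTwoSmooth (fun x : E => ‖x‖) β)
    {ℱ : Filtration ℕ mΩ} {D : ℕ → Ω → E} {k : ℕ} {b c : ℝ}
    (hD : ∀ m, k < m → StronglyMeasurable[ℱ m] (D m))
    (hD0 : ∀ m, k < m → P[D m | ℱ (m - 1)] =ᵐ[P] 0)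
    (hDb : ∀ m, k < m → ∀ᵐ ω ∂P, ‖D m ω‖ ≤ b) (hc0 : 0 ≤ c)
    (hc : ∀ m, k < m → ∀ᵐ ω ∂P,
      β ^ 2 * P[fun ω => Real.exp ‖D m ω‖ - 1 - ‖D m ω‖ | ℱ (m - 1)] ω ≤ c)
    {n : ℕ} (hkn : k ≤ n) :
    Integrable (fun ω => Real.cosh ‖∑ m ∈ Finset.Ioc k n, D m ω‖) P ∧
      ∫ ω, Real.cosh ‖∑ m ∈ Finset.Ioc k n, D m ω‖ ∂P ≤ (1 + c) ^ (n - k) := by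
  have hmeas : ∀ j, k ≤ j → StronglyMeasurable[ℱ j] (fun ω => ∑ m ∈ Finset.Ioc k j, D m ω) := by
    intro j hj
    refine Finset.stronglyMeasurable_fun_sum _ fun m hm => ?_
    rw [Finset.mem_Ioc] at hm
    exact (hD m hm.1).mono (ℱ.mono hm.2)
  have hbdd : ∀ j, k ≤ j → ∀ᵐ ω ∂P, ‖∑ m ∈ Finset.Ioc k j, D m ω‖ ≤ (j - k : ℕ) * b := by
    intro j hj
    have : ∀ᵐ ω ∂P, ∀ m ∈ Finset.Ioc k j, ‖D m ω‖ ≤ b := by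
      exact (Finset.eventually_all _).2 fun m hm => hDb m (Finset.mem_Ioc.1 hm).1
    filter_upwards [this] with ω hω
    refine (norm_sum_le_of_le _ hω).trans ?_
    simp
  refine ⟨?_, ?_⟩
  · refine Integrable.of_bound (Real.continuous_cosh.comp_aestronglyMeasurable
      ((hmeas n hkn).mono (ℱ.le n)).aestronglyMeasurable.norm) (Real.cosh ((n - k : ℕ) * b)) ?_
    filter_upwards [hbdd n hkn] with ω hω
    rw [Real.norm_of_nonneg (Real.cosh_pos _).le, Real.cosh_le_cosh, abs_norm]
    exact hω.trans (le_abs_self _)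
  · induction n, hkn using Nat.le_induction with
    | base => simp
    | succ n hkn ih =>
      have h1 := h.integral_cosh_norm_add_le (ℱ.le n) (hmeas n hkn)
        ((hD (n + 1) (by omega)).mono (ℱ.le _)).aestronglyMeasurable (hD0 (n + 1) (by omega))
        (hbdd n hkn) (hDb (n + 1) (by omega)) (hc (n + 1) (by omega))
      simp only [Finset.sum_Ioc_succ_top hkn]
      refine h1.trans ?_
      rw [Nat.succ_sub hkn, pow_succ']
      gcongr

/-- Markov's inequality for cosh ≥ exp / 2. The resulting prefactor 2 is the one in log (2 / δ₁). -/
lemma IsTwoSmooth.measureReal_norm_sum_ge_le (h : IsTwoSmooth (fun x : E => ‖x‖) β)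
    {ℱ : Filtration ℕ mΩ} {D : ℕ → Ω → E} {k : ℕ} {b c : ℝ}
    (hD : ∀ m, k < m → StronglyMeasurable[ℱ m] (D m))
    (hD0 : ∀ m, k < m → P[D m | ℱ (m - 1)] =ᵐ[P] 0)
    (hDb : ∀ m, k < m → ∀ᵐ ω ∂P, ‖D m ω‖ ≤ b) (hc0 : 0 ≤ c)
    (hc : ∀ m, k < m → ∀ᵐ ω ∂P,
      β ^ 2 * P[fun ω => Real.exp ‖D m ω‖ - 1 - ‖D m ω‖ | ℱ (m - 1)] ω ≤ c)
    {n : ℕ} (hkn : k ≤ n) (t : ℝ) :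
    P.real {ω | t ≤ ‖∑ m ∈ Finset.Ioc k n, D m ω‖} ≤
      2 * Real.exp ((n - k : ℕ) * c - t) := by
  obtain ⟨hi, hle⟩ := h.integral_cosh_norm_sum_le hD hD0 hDb hc0 hc hkn
  have h1 := mul_meas_ge_le_integral_of_nonneg (μ := P)
    (Eventually.of_forall fun ω => (Real.cosh_pos _).le) hi (Real.exp t / 2)
  have h2 : P.real {ω | t ≤ ‖∑ m ∈ Finset.Ioc k n, D m ω‖} ≤
      P.real {ω | Real.exp t / 2 ≤ Real.cosh ‖∑ m ∈ Finset.Ioc k n, D m ω‖} := by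
    refine measureReal_mono fun ω hω => ?_
    simp only [Set.mem_ofPred_eq] at hω ⊢
    rw [Real.cosh_eq]
    have := Real.exp_le_exp.2 hω
    linarith [Real.exp_pos (-‖∑ m ∈ Finset.Ioc k n, D m ω‖)]
  have h3 : (1 + c) ^ (n - k) ≤ Real.exp ((n - k : ℕ) * c) := by
    rw [Real.exp_nat_mul]
    gcongr
    linarith [Real.add_one_le_exp c]
  rw [Real.exp_sub]
  have ht := Real.exp_pos t
  rw [← mul_div_assoc, le_div_iff₀ ht]
  have : Real.exp t / 2 * P.real {ω | t ≤ ‖∑ m ∈ Finset.Ioc k n, D m ω‖} ≤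
    Real.exp ((n - k : ℕ) * c) := (mul_le_mul_of_nonneg_left h2 (by positivity)).trans
      (h1.trans (hle.trans h3))
  linarith

/-- Jensen bounds the mean of ‖S - d‖ ^ p below by that of ‖S‖ ^ p. This leaves coefficient 1 in
front of ‖S‖ ^ p, so that the bound can be iterated without loss. -/
lemma IsTwoSmooth.integral_norm_add_rpow_le (h : IsTwoSmooth (fun x : E => ‖x‖) β)
    (hβ : 0 < β) {p : ℝ} (hp : 1 < p) (hp2 : p ≤ 2)
    (hm : m ≤ mΩ) {S d : Ω → E} (hS : StronglyMeasurable[m] S)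
    (hSi : Integrable S P) (hd : Integrable d P) (hd0 : P[d | m] =ᵐ[P] 0)
    (hSp : Integrable (fun ω => ‖S ω‖ ^ p) P) (hdp : Integrable (fun ω => ‖d ω‖ ^ p) P) :
    Integrable (fun ω => ‖S ω + d ω‖ ^ p) P ∧
      ∫ ω, ‖S ω + d ω‖ ^ p ∂P ≤ ∫ ω, ‖S ω‖ ^ p ∂P + 2 * β ^ p * ∫ ω, ‖d ω‖ ^ p ∂P := by
  have hp0 : 0 ≤ p := by linarith
  have hle := fun ω => h.rpow_norm_add_add_rpow_norm_sub_le hβ hp hp2 (S ω) (d ω)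
  have hbi : Integrable (fun ω => 2 * ‖S ω‖ ^ p + 2 * β ^ p * ‖d ω‖ ^ p) P :=
    (hSp.const_mul _).add (hdp.const_mul _)
  have hc : Continuous fun x : E => ‖x‖ ^ p := continuous_norm.rpow_const fun _ => Or.inr hp0
  have h0 : ∀ x : E, 0 ≤ ‖x‖ ^ p := fun x => by positivity
  have hi1 : Integrable (fun ω => ‖S ω + d ω‖ ^ p) P := by
    refine hbi.mono' (hc.comp_aestronglyMeasurable (hSi.add hd).aestronglyMeasurable)
      (Eventually.of_forall fun ω => ?_)
    rw [Real.norm_of_nonneg (h0 _)]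
    linarith [hle ω, h0 (S ω - d ω)]
  have hi2 : Integrable (fun ω => ‖S ω - d ω‖ ^ p) P := by
    refine hbi.mono' (hc.comp_aestronglyMeasurable (hSi.sub hd).aestronglyMeasurable)
      (Eventually.of_forall fun ω => ?_)
    rw [Real.norm_of_nonneg (h0 _)]
    linarith [hle ω, h0 (S ω + d ω)]
  refine ⟨hi1, ?_⟩
  have hJ := (convexOn_norm_rpow (E := E) hp.le).integral_le_integral_sub hc hm hS hSi hd hd0
    hSp hi2
  have h1 := integral_mono (hi1.add hi2) hbi hle
  rw [integral_add' hi1 hi2, integral_add (hSp.const_mul _) (hdp.const_mul _),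
    integral_const_mul, integral_const_mul] at h1
  linarith

/-- A von Bahr–Esseen inequality for martingale differences in a smooth Banach space. -/
lemma IsTwoSmooth.integral_norm_sum_rpow_le (h : IsTwoSmooth (fun x : E => ‖x‖) β)
    (hβ : 0 < β) {p : ℝ} (hp : 1 < p) (hp2 : p ≤ 2) {ℱ : Filtration ℕ mΩ} {D : ℕ → Ω → E} {k : ℕ}
    (hD : ∀ m, k < m → StronglyMeasurable[ℱ m] (D m)) (hDi : ∀ m, k < m → Integrable (D m) P)
    (hD0 : ∀ m, k < m → P[D m | ℱ (m - 1)] =ᵐ[P] 0)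
    (hDp : ∀ m, k < m → Integrable (fun ω => ‖D m ω‖ ^ p) P) {n : ℕ} (hkn : k ≤ n) :
    Integrable (fun ω => ‖∑ m ∈ Finset.Ioc k n, D m ω‖ ^ p) P ∧
      ∫ ω, ‖∑ m ∈ Finset.Ioc k n, D m ω‖ ^ p ∂P ≤
        2 * β ^ p * ∑ m ∈ Finset.Ioc k n, ∫ ω, ‖D m ω‖ ^ p ∂P := by
  induction n, hkn using Nat.le_induction with
  | base => simp [Real.zero_rpow (by linarith : p ≠ 0)]
  | succ n hkn ih =>
    have hmeas : StronglyMeasurable[ℱ n] (fun ω => ∑ m ∈ Finset.Ioc k n, D m ω) := by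
      refine Finset.stronglyMeasurable_fun_sum _ fun m hm => ?_
      rw [Finset.mem_Ioc] at hm
      exact (hD m hm.1).mono (ℱ.mono hm.2)
    have hint : Integrable (fun ω => ∑ m ∈ Finset.Ioc k n, D m ω) P :=
      integrable_finsetSum _ fun m hm => hDi m (Finset.mem_Ioc.1 hm).1
    have h1 := h.integral_norm_add_rpow_le hβ hp hp2 (ℱ.le n) hmeas hint
      (hDi (n + 1) (by omega)) (hD0 (n + 1) (by omega)) ih.1 (hDp (n + 1) (by omega))
    simp only [Finset.sum_Ioc_succ_top hkn]
    refine ⟨h1.1, h1.2.trans ?_⟩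
    rw [mul_add]
    linarith [ih.2]

end Martingale

/-! ### Conditional second moments after centring -/

section CondVariance

variable {Ω : Type*} {m mΩ : MeasurableSpace Ω} {P : Measure Ω} [IsProbabilityMeasure P]

lemma condExp_norm_sub_condExp_sq_le_of_inner {E : Type*} [NormedAddCommGroup E]
    [InnerProductSpace ℝ E] [CompleteSpace E] (hm : m ≤ mΩ) {Y : Ω → E}
    (hY : AEStronglyMeasurable Y P) {b : ℝ} (hYb : ∀ᵐ ω ∂P, ‖Y ω‖ ≤ b)
    (hCb : ∀ᵐ ω ∂P, ‖P[Y | m] ω‖ ≤ b) :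
    P[fun ω => ‖Y ω - P[Y | m] ω‖ ^ 2 | m] ≤ᵐ[P] P[fun ω => ‖Y ω‖ ^ 2 | m] := by
  have hYi : Integrable Y P := Integrable.of_bound hY b hYb
  have hCm : AEStronglyMeasurable (P[Y | m]) P := integrable_condExp.aestronglyMeasurable
  have hinner : Integrable (fun ω => innerSL ℝ (P[Y | m] ω) (Y ω)) P := by
    refine Integrable.of_bound ?_ (b * b) ?_
    · exact hCm.inner hY
    · filter_upwards [hYb, hCb] with ω h1 h2
      have := norm_inner_le_norm (𝕜 := ℝ) (P[Y | m] ω) (Y ω)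
      rw [innerSL_apply_apply]
      exact this.trans (mul_le_mul h2 h1 (norm_nonneg _) ((norm_nonneg _).trans h1))
  have hsq : Integrable (fun ω => ‖Y ω‖ ^ 2) P := by
    refine Integrable.of_bound (by fun_prop) (b ^ 2) ?_
    filter_upwards [hYb] with ω h1
    rw [norm_pow, norm_norm]
    gcongr
  have hCsq : Integrable (fun ω => ‖P[Y | m] ω‖ ^ 2) P := by
    refine Integrable.of_bound (by fun_prop) (b ^ 2) ?_
    filter_upwards [hCb] with ω h1
    rw [norm_pow, norm_norm]
    gcongr
  have hpull := condExp_bilin_of_stronglyMeasurable_left (innerSL ℝ)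
    (stronglyMeasurable_condExp (f := Y) (m := m) (μ := P)) hinner hYi
  have heq : (fun ω => ‖Y ω - P[Y | m] ω‖ ^ 2) =
      ((fun ω => ‖Y ω‖ ^ 2) - (2 : ℝ) • fun ω => innerSL ℝ (P[Y | m] ω) (Y ω)) +
        fun ω => ‖P[Y | m] ω‖ ^ 2 := by
    ext ω
    simp only [Pi.add_apply, Pi.sub_apply, Pi.smul_apply, innerSL_apply_apply, smul_eq_mul]
    rw [norm_sub_sq_real, real_inner_comm]
  have hC : P[fun ω => ‖P[Y | m] ω‖ ^ 2 | m] = fun ω => ‖P[Y | m] ω‖ ^ 2 :=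
    condExp_of_stronglyMeasurable hm
      ((continuous_pow 2).comp_stronglyMeasurable stronglyMeasurable_condExp.norm) hCsq
  rw [heq]
  filter_upwards [condExp_add (hsq.sub (hinner.smul (2 : ℝ))) hCsq m,
    condExp_sub hsq (hinner.smul (2 : ℝ)) m,
    condExp_smul (2 : ℝ) (fun ω => innerSL ℝ (P[Y | m] ω) (Y ω)) m, hpull] with ω h1 h2 h3 h4
  rw [h1, Pi.add_apply, h2, Pi.sub_apply, h3, Pi.smul_apply, h4, hC, innerSL_apply_apply,
    real_inner_self_eq_norm_sq, smul_eq_mul]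
  linarith [sq_nonneg ‖P[Y | m] ω‖]

variable {E : Type*} [NormedAddCommGroup E] [NormedSpace ℝ E] [CompleteSpace E]

/-- The bilinear form gives the parallelogram law, hence an inner product for the same norm, and the
square can be expanded. -/
lemma IsHilbertNorm.condExp_norm_sub_condExp_sq_le (h : IsHilbertNorm E) (hm : m ≤ mΩ)
    {Y : Ω → E} (hY : AEStronglyMeasurable Y P) {b : ℝ} (hYb : ∀ᵐ ω ∂P, ‖Y ω‖ ≤ b)
    (hCb : ∀ᵐ ω ∂P, ‖P[Y | m] ω‖ ≤ b) :
    P[fun ω => ‖Y ω - P[Y | m] ω‖ ^ 2 | m] ≤ᵐ[P] P[fun ω => ‖Y ω‖ ^ 2 | m] := by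
  obtain ⟨B, -, hB⟩ := h
  let _ : InnerProductSpace ℝ E := InnerProductSpace.ofNorm ℝ fun x y => by
    simp only [← sq, ← hB, map_add, map_sub, LinearMap.add_apply, LinearMap.sub_apply]
    ring
  exact condExp_norm_sub_condExp_sq_le_of_inner hm hY hYb hCb

/-- Without an inner product, ‖Y - C‖² ≤ 2‖Y‖² + 2‖C‖² and Jensen cost a factor 4, which is why
`frakC` has 2^(p+1) in place of 2^(p-1). -/
lemma condExp_norm_sub_condExp_sq_le (hm : m ≤ mΩ)
    {Y : Ω → E} (hY : AEStronglyMeasurable Y P) {b : ℝ} (hYb : ∀ᵐ ω ∂P, ‖Y ω‖ ≤ b)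
    (hCb : ∀ᵐ ω ∂P, ‖P[Y | m] ω‖ ≤ b) :
    P[fun ω => ‖Y ω - P[Y | m] ω‖ ^ 2 | m] ≤ᵐ[P]
      (4 : ℝ) • P[fun ω => ‖Y ω‖ ^ 2 | m] := by
  have hCm : AEStronglyMeasurable (P[Y | m]) P := integrable_condExp.aestronglyMeasurable
  have hsq : Integrable (fun ω => ‖Y ω‖ ^ 2) P := by
    refine Integrable.of_bound (by fun_prop) (b ^ 2) ?_
    filter_upwards [hYb] with ω h1
    rw [norm_pow, norm_norm]
    gcongr
  have hCsq : Integrable (fun ω => ‖P[Y | m] ω‖ ^ 2) P := by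
    refine Integrable.of_bound (by fun_prop) (b ^ 2) ?_
    filter_upwards [hCb] with ω h1
    rw [norm_pow, norm_norm]
    gcongr
  have hle : ∀ ω, ‖Y ω - P[Y | m] ω‖ ^ 2 ≤
      ((2 : ℝ) • ((fun ω => ‖Y ω‖ ^ 2) + fun ω => ‖P[Y | m] ω‖ ^ 2)) ω := by
    intro ω
    simp only [Pi.add_apply, Pi.smul_apply, smul_eq_mul]
    have := norm_sub_le (Y ω) (P[Y | m] ω)
    nlinarith [sq_nonneg (‖Y ω‖ - ‖P[Y | m] ω‖), norm_nonneg (Y ω - P[Y | m] ω),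
      norm_nonneg (Y ω), norm_nonneg (P[Y | m] ω)]
  have hsumi := (hsq.add hCsq).smul (2 : ℝ)
  have hdi : Integrable (fun ω => ‖Y ω - P[Y | m] ω‖ ^ 2) P :=
    hsumi.mono' (by fun_prop) (Eventually.of_forall fun ω => by
      rw [Real.norm_of_nonneg (by positivity)]; exact hle ω)
  have hC : P[fun ω => ‖P[Y | m] ω‖ ^ 2 | m] = fun ω => ‖P[Y | m] ω‖ ^ 2 :=
    condExp_of_stronglyMeasurable hm
      ((continuous_pow 2).comp_stronglyMeasurable stronglyMeasurable_condExp.norm) hCsq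
  have hJ := Integrable.norm_condExp_rpow_le (f := Y) (μ := P) (m := m) (p := 2) (by norm_num)
    (by simpa using hsq)
  simp only [Real.rpow_two] at hJ
  filter_upwards [condExp_mono hdi hsumi (Eventually.of_forall hle) (m := m),
    condExp_smul (2 : ℝ) ((fun ω => ‖Y ω‖ ^ 2) + fun ω => ‖P[Y | m] ω‖ ^ 2) m,
    condExp_add hsq hCsq m, hJ] with ω h1 h2 h3 h4
  refine h1.trans ?_
  rw [h2, Pi.smul_apply, h3, Pi.add_apply, hC, Pi.smul_apply, smul_eq_mul, smul_eq_mul]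
  linarith

end CondVariance

lemma frakC_pos (E : Type*) [NormedAddCommGroup E] [NormedSpace ℝ E] (p : ℝ) {ρ : ℝ} (hρ : 0 < ρ) :
    0 < frakC E p ρ := by
  unfold frakC
  have h1 : 0 < Real.exp (2 * ρ) - 2 * ρ - 1 := by
    have := Real.add_one_lt_exp (x := 2 * ρ) (by positivity)
    linarith
  refine mul_pos ?_ (by positivity)
  split_ifs <;> positivity

/-! ### Exponential moment of one truncated increment -/

section Increment

variable {E Ω : Type*} [NormedAddCommGroup E] [NormedSpace ℝ E] [CompleteSpace E]
  {m mΩ : MeasurableSpace Ω} {P : Measure Ω} [IsProbabilityMeasure P] {β p lam v : ℝ}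

/-- The scaled centred increment has norm at most 2 / β, so exp x - 1 - x is at most φ x² with φ its
quotient by x² at 2 / β. The factor β² cancels the scaling by 1 / β. Finally lam * ‖Y‖ ≤ 1 and p ≤ 2
bound the second moment by the p-th one. -/
lemma sq_mul_condExp_exp_norm_le (hm : m ≤ mΩ) (hβ : 0 < β) (hp2 : p ≤ 2)
    (hl : 0 < lam) {Y : Ω → E} (hY : AEStronglyMeasurable Y P)
    (hYb : ∀ ω, ‖Y ω‖ ≤ lam⁻¹) (hYp : Integrable (fun ω => ‖Y ω‖ ^ p) P)
    (hYv : P[fun ω => ‖Y ω‖ ^ p | m] ≤ᵐ[P] fun _ => 2 ^ (p - 1) * v) :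
    (∀ᵐ ω ∂P, ‖(lam / β) • (Y ω - P[Y | m] ω)‖ ≤ 2 * β⁻¹) ∧
    ∀ᵐ ω ∂P, β ^ 2 * P[fun ω => Real.exp ‖(lam / β) • (Y ω - P[Y | m] ω)‖ - 1 -
      ‖(lam / β) • (Y ω - P[Y | m] ω)‖ | m] ω ≤ frakC E p β⁻¹ * lam ^ p * v := by
  have hYb' : ∀ᵐ ω ∂P, ‖Y ω‖ ≤ lam⁻¹ := Eventually.of_forall hYb
  have hCb : ∀ᵐ ω ∂P, ‖P[Y | m] ω‖ ≤ lam⁻¹ := ae_bdd_norm_condExp_of_ae_bdd_norm hYb'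
  have hCm : AEStronglyMeasurable (P[Y | m]) P := integrable_condExp.aestronglyMeasurable
  have hDb : ∀ᵐ ω ∂P, ‖(lam / β) • (Y ω - P[Y | m] ω)‖ ≤ 2 * β⁻¹ := by
    filter_upwards [hCb] with ω h1
    rw [norm_smul, Real.norm_of_nonneg (by positivity)]
    calc lam / β * ‖Y ω - P[Y | m] ω‖ ≤ lam / β * (lam⁻¹ + lam⁻¹) := by
          gcongr; exact (norm_sub_le _ _).trans (add_le_add (hYb ω) h1)
      _ = _ := by field_simp; ring
  refine ⟨hDb, ?_⟩
  have hsq : Integrable (fun ω => ‖Y ω‖ ^ 2) P := by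
    refine Integrable.of_bound (by fun_prop) (lam⁻¹ ^ 2) (Eventually.of_forall fun ω => ?_)
    rw [norm_pow, norm_norm]
    gcongr
    exact hYb ω
  have hdsq : Integrable (fun ω => ‖Y ω - P[Y | m] ω‖ ^ 2) P := by
    refine Integrable.of_bound (by fun_prop) ((lam⁻¹ + lam⁻¹) ^ 2) ?_
    filter_upwards [hCb] with ω h1
    rw [norm_pow, norm_norm]
    gcongr
    exact (norm_sub_le _ _).trans (add_le_add (hYb ω) h1)
  set φ : ℝ := (Real.exp (2 * β⁻¹) - 2 * β⁻¹ - 1) / (2 * β⁻¹) ^ 2 with hφ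
  have hφ0 : 0 ≤ φ := by
    have := exp_sub_one_sub_nonneg (2 * β⁻¹)
    exact div_nonneg (by linarith) (by positivity)
  have he : Integrable (fun ω => Real.exp ‖(lam / β) • (Y ω - P[Y | m] ω)‖ - 1 -
      ‖(lam / β) • (Y ω - P[Y | m] ω)‖) P := by
    refine Integrable.of_bound (by fun_prop) (Real.exp (2 * β⁻¹)) ?_
    filter_upwards [hDb] with ω h2
    rw [Real.norm_of_nonneg (exp_sub_one_sub_nonneg _)]
    have := Real.exp_le_exp.2 h2
    linarith [norm_nonneg ((lam / β) • (Y ω - P[Y | m] ω))]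
  have hele : (fun ω => Real.exp ‖(lam / β) • (Y ω - P[Y | m] ω)‖ - 1 -
      ‖(lam / β) • (Y ω - P[Y | m] ω)‖) ≤ᵐ[P]
      (φ * (lam / β) ^ 2) • fun ω => ‖Y ω - P[Y | m] ω‖ ^ 2 := by
    filter_upwards [hDb] with ω h2
    refine (exp_sub_one_sub_le_sq_mul (norm_nonneg _) h2 (by positivity)).trans (le_of_eq ?_)
    rw [norm_smul, Real.norm_of_nonneg (by positivity), Pi.smul_apply, smul_eq_mul, hφ, div_pow,
      mul_pow]
    ring
  have hYsq : P[fun ω => ‖Y ω‖ ^ 2 | m] ≤ᵐ[P] fun _ => lam ^ p / lam ^ 2 * (2 ^ (p - 1) * v) := by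
    have hle : ∀ ω, ‖Y ω‖ ^ 2 ≤ ((lam ^ p / lam ^ 2) • fun ω => ‖Y ω‖ ^ p) ω := by
      intro ω
      have h1 : lam * ‖Y ω‖ ≤ 1 := by
        calc lam * ‖Y ω‖ ≤ lam * lam⁻¹ := by gcongr; exact hYb ω
          _ = 1 := mul_inv_cancel₀ hl.ne'
      have h2 : (lam * ‖Y ω‖) ^ 2 ≤ (lam * ‖Y ω‖) ^ p := by
        rcases eq_or_lt_of_le (norm_nonneg (Y ω)) with h0 | h0
        · rw [← h0, mul_zero]
          simp only [ne_eq, OfNat.ofNat_ne_zero, not_false_eq_true, zero_pow]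
          exact Real.rpow_nonneg le_rfl _
        · rw [← Real.rpow_two]
          exact Real.rpow_le_rpow_of_exponent_ge (by positivity) h1 hp2
      rw [mul_pow, Real.mul_rpow hl.le (norm_nonneg _)] at h2
      rw [Pi.smul_apply, smul_eq_mul, div_mul_eq_mul_div, le_div_iff₀ (by positivity)]
      linarith
    filter_upwards [condExp_mono hsq (hYp.smul _) (Eventually.of_forall hle) (m := m),
      condExp_smul (lam ^ p / lam ^ 2) (fun ω => ‖Y ω‖ ^ p) m, hYv] with ω h1 h2 h3
    refine h1.trans ?_
    rw [h2, Pi.smul_apply, smul_eq_mul]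
    gcongr
  have hvar : ∀ᵐ ω ∂P, P[fun ω => ‖Y ω - P[Y | m] ω‖ ^ 2 | m] ω * φ ≤
      frakC E p β⁻¹ * (lam ^ p / lam ^ 2) * v := by
    unfold frakC
    rw [← hφ]
    split_ifs with hH
    · filter_upwards [hH.condExp_norm_sub_condExp_sq_le hm hY hYb' hCb, hYsq] with ω h1 h2
      calc _ ≤ lam ^ p / lam ^ 2 * (2 ^ (p - 1) * v) * φ := by gcongr; exact h1.trans h2
        _ = _ := by ring
    · filter_upwards [condExp_norm_sub_condExp_sq_le hm hY hYb' hCb, hYsq] with ω h1 h2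
      have h3 : (2 : ℝ) ^ (p + 1) = 4 * 2 ^ (p - 1) := by
        rw [show p + 1 = (p - 1) + 2 by ring, Real.rpow_add (by norm_num)]; norm_num; ring
      rw [Pi.smul_apply, smul_eq_mul] at h1
      calc _ ≤ 4 * (lam ^ p / lam ^ 2 * (2 ^ (p - 1) * v)) * φ := by
            gcongr; exact h1.trans (by gcongr)
        _ = _ := by rw [h3]; ring
  filter_upwards [condExp_mono he (hdsq.smul _) hele (m := m),
    condExp_smul (φ * (lam / β) ^ 2) (fun ω => ‖Y ω - P[Y | m] ω‖ ^ 2) m, hvar] with ω h1 h2 h3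
  rw [h2, Pi.smul_apply, smul_eq_mul] at h1
  calc _ ≤ β ^ 2 * (φ * (lam / β) ^ 2 * P[fun ω => ‖Y ω - P[Y | m] ω‖ ^ 2 | m] ω) := by gcongr
    _ = lam ^ 2 * (P[fun ω => ‖Y ω - P[Y | m] ω‖ ^ 2 | m] ω * φ) := by field_simp
    _ ≤ lam ^ 2 * (frakC E p β⁻¹ * (lam ^ p / lam ^ 2) * v) := by gcongr
    _ = _ := by field_simp

end Increment

/-! ### The truncated mean around a general centre -/

lemma templateConst_pos (E : Type*) [NormedAddCommGroup E] [NormedSpace ℝ E] {p β : ℝ}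
    (hp : 1 < p) (hβ : 0 < β) : 0 < templateConst E p β := by
  have h1 := frakC_pos E p (inv_pos.2 hβ)
  have h2 := constK_pos hp
  unfold templateConst
  positivity

lemma norm_sub_rpow_le {E : Type*} [NormedAddCommGroup E] {p : ℝ} (hp : 1 ≤ p) (x μ z : E) :
    ‖x - z‖ ^ p ≤ 2 ^ (p - 1) * (‖x - μ‖ ^ p + ‖z - μ‖ ^ p) := by
  have h1 : ‖x - z‖ ≤ ‖x - μ‖ + ‖z - μ‖ := by
    have := norm_sub_le (x - μ) (z - μ)
    rwa [sub_sub_sub_cancel_right] at this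
  refine (Real.rpow_le_rpow (norm_nonneg _) h1 (by linarith)).trans ?_
  have := NNReal.rpow_add_le_mul_rpow_add_rpow ‖x - μ‖₊ ‖z - μ‖₊ hp
  exact_mod_cast this

lemma two_mul_exp_neg_log {δ : ℝ} (hδ : 0 < δ) : 2 * Real.exp (-Real.log (2 / δ)) = δ := by
  rw [Real.exp_neg, Real.exp_log (by positivity)]
  field_simp

/-- The deviation term decreases in lam and the bias term increases. This choice makes each equal to
(T V)^(1/p) (β L / N)^((p-1)/p), whence the factor 2. -/
lemma optLam_bound {p β lam T V L N : ℝ} (hp : 1 < p) (hβ : 0 < β) (hT : 0 < T) (hV : 0 < V) (hL : 0 < L)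
    (hN : 0 < N) (hlam : lam = (β * L / (N * (T * V))) ^ (1 / p)) :
    β * L / (lam * N) + T * lam ^ (p - 1) * V =
      2 * (T * V) ^ (1 / p) * (β * L / N) ^ ((p - 1) / p) := by
  have hp0 : 0 < p := by linarith
  set a := T * V with ha
  set b := β * L / N with hb
  have ha0 : 0 < a := by positivity
  have hb0 : 0 < b := by positivity
  have hlam' : lam = b ^ (1 / p) / a ^ (1 / p) := by
    rw [hlam, ← Real.div_rpow hb0.le ha0.le, hb]
    congr 1
    field_simp
  have hl : 0 < lam := by rw [hlam']; positivity
  have e1 : b = b ^ (1 / p) * b ^ ((p - 1) / p) := by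
    rw [← Real.rpow_add hb0, ← add_div, add_sub_cancel, div_self hp0.ne', Real.rpow_one]
  have e2 : a = a ^ (1 / p) * a ^ ((p - 1) / p) := by
    rw [← Real.rpow_add ha0, ← add_div, add_sub_cancel, div_self hp0.ne', Real.rpow_one]
  have e3 : lam ^ (p - 1) = b ^ ((p - 1) / p) / a ^ ((p - 1) / p) := by
    rw [hlam', Real.div_rpow (by positivity) (by positivity), ← Real.rpow_mul hb0.le,
      ← Real.rpow_mul ha0.le, one_div_mul_eq_div]
  have h1 : β * L / (lam * N) = b / lam := by rw [hb]; field_simp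
  have h2 : T * lam ^ (p - 1) * V = a * lam ^ (p - 1) := by rw [ha]; ring
  have hA : 0 < a ^ (1 / p) := by positivity
  have hA' : 0 < a ^ ((p - 1) / p) := by positivity
  have hB : 0 < b ^ (1 / p) := by positivity
  have f1 : b / lam = a ^ (1 / p) * b ^ ((p - 1) / p) := by
    rw [div_eq_iff hl.ne', hlam']
    nth_rewrite 1 [e1]
    field_simp
  have f2 : a * lam ^ (p - 1) = a ^ (1 / p) * b ^ ((p - 1) / p) := by
    rw [e3]
    nth_rewrite 1 [e2]
    field_simp
  rw [h1, h2, f1, f2]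
  ring

section TruncatedMean

variable {E Ω : Type*} [NormedAddCommGroup E] [NormedSpace ℝ E]

lemma MeasureTheory.StronglyMeasurable.truncFactor_smul {m : MeasurableSpace Ω} {f : Ω → E}
    (hf : StronglyMeasurable[m] f) (lam : ℝ) :
    StronglyMeasurable[m] (fun ω => truncFactor (lam • f ω) • f ω) := by
  have h1 : Measurable (fun t : ℝ => min 1 t / t) := by fun_prop
  have h2 : StronglyMeasurable[m] (fun ω => truncFactor (lam • f ω)) :=
    (h1.comp (hf.const_smul lam).norm.measurable).stronglyMeasurable
  exact h2.smul hf

variable [CompleteSpace E] {mΩ : MeasurableSpace Ω} {P : Measure Ω} [IsProbabilityMeasure P]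
  {β p v lam r : ℝ} {ℱ : Filtration ℕ mΩ} {X : ℕ → Ω → E} {μ : E} {Z : Ω → E} {k n : ℕ}

/-- Concentration of the truncated mean around a centre within `r` of the mean. -/
lemma IsHeavyTailedSequence.measureReal_truncatedMean_le (h : IsTwoSmooth (fun x : E => ‖x‖) β)
    (hX : IsHeavyTailedSequence P ℱ X μ p v) (hp : 1 < p) (hp2 : p ≤ 2) (hv : 0 < v) (hβ : 0 < β)
    (hr : 0 ≤ r) (hl : 0 < lam) (hkn : k < n) (hZ : StronglyMeasurable[ℱ k] Z)
    (hZr : ∀ ω, ‖Z ω - μ‖ ≤ r) (L : ℝ) :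
    P.real {ω | ¬ ‖truncatedMean X Z lam k n ω - μ‖ ≤
      β * L / (lam * ((n : ℝ) - k)) + templateConst E p β * lam ^ (p - 1) * (v + r ^ p)} ≤
      2 * Real.exp (-L) := by
  set N : ℝ := (n : ℝ) - k with hN
  have hN0 : 0 < N := by rw [hN, sub_pos]; exact_mod_cast hkn
  have hNk : ((n - k : ℕ) : ℝ) = N := by rw [Nat.cast_sub hkn.le]
  set V : ℝ := v + r ^ p with hV
  have hV0 : 0 < V := by have := Real.rpow_nonneg hr p; linarith
  set Y : ℕ → Ω → E := fun m ω => truncFactor (lam • (X m ω - Z ω)) • (X m ω - Z ω) with hY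
  set D : ℕ → Ω → E := fun m ω => (lam / β) • (Y m ω - P[Y m | ℱ (m - 1)] ω) with hD
  have hZm : ∀ m, k < m → StronglyMeasurable[ℱ (m - 1)] Z := fun m hm =>
    hZ.mono (ℱ.mono (by omega))
  have hZi : Integrable Z P := by
    refine Integrable.of_bound (hZ.mono (ℱ.le k)).aestronglyMeasurable (r + ‖μ‖)
      (Eventually.of_forall fun ω => ?_)
    calc ‖Z ω‖ = ‖(Z ω - μ) + μ‖ := by rw [sub_add_cancel]
      _ ≤ _ := (norm_add_le _ _).trans (by gcongr; exact hZr ω)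
  have hYm : ∀ m, k < m → StronglyMeasurable[ℱ m] (Y m) := fun m hm =>
    ((hX.adapted m (by omega)).sub (hZ.mono (ℱ.mono hm.le))).truncFactor_smul lam
  have hYae : ∀ m, k < m → AEStronglyMeasurable (Y m) P := fun m hm =>
    ((hYm m hm).mono (ℱ.le m)).aestronglyMeasurable
  have hYb : ∀ m ω, ‖Y m ω‖ ≤ lam⁻¹ := fun m ω => norm_truncFactor_smul_le hl _
  have hYi : ∀ m, k < m → Integrable (Y m) P := fun m hm =>
    Integrable.of_bound (hYae m hm) _ (Eventually.of_forall (hYb m))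
  have hXZi : ∀ m, k < m → Integrable (fun ω => X m ω - Z ω) P := fun m hm =>
    (hX.integrable m (by omega)).sub hZi
  have hcont : Continuous fun x : E => ‖x‖ ^ p :=
    continuous_norm.rpow_const fun _ => Or.inr (by linarith)
  have hmaj : ∀ m, k < m → Integrable (fun ω => 2 ^ (p - 1) * (‖X m ω - μ‖ ^ p + r ^ p)) P :=
    fun m hm => ((hX.integrable_moment m (by omega)).add (integrable_const _)).const_mul _
  have hXZle : ∀ m ω, ‖X m ω - Z ω‖ ^ p ≤ 2 ^ (p - 1) * (‖X m ω - μ‖ ^ p + r ^ p) := by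
    intro m ω
    refine (norm_sub_rpow_le hp.le _ μ _).trans ?_
    gcongr
    exact hZr ω
  have hXZp : ∀ m, k < m → Integrable (fun ω => ‖X m ω - Z ω‖ ^ p) P := fun m hm =>
    (hmaj m hm).mono' (hcont.comp_aestronglyMeasurable (hXZi m hm).aestronglyMeasurable)
      (Eventually.of_forall fun ω => by
        rw [Real.norm_of_nonneg (by positivity)]; exact hXZle m ω)
  have hXZv : ∀ m, k < m →
      P[fun ω => ‖X m ω - Z ω‖ ^ p | ℱ (m - 1)] ≤ᵐ[P] fun _ => 2 ^ (p - 1) * V := by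
    intro m hm
    filter_upwards [condExp_mono (hXZp m hm) (hmaj m hm) (Eventually.of_forall (hXZle m))
      (m := ℱ (m - 1)), condExp_smul ((2 : ℝ) ^ (p - 1)) ((fun ω => ‖X m ω - μ‖ ^ p) +
        fun _ => r ^ p) (ℱ (m - 1)), condExp_add (hX.integrable_moment m (by omega))
        (integrable_const (r ^ p)) (ℱ (m - 1)), hX.condMoment m (by omega)] with ω h1 h2 h3 h4
    refine h1.trans ?_
    have h5 : (fun ω => 2 ^ (p - 1) * (‖X m ω - μ‖ ^ p + r ^ p)) =
      (2 : ℝ) ^ (p - 1) • ((fun ω => ‖X m ω - μ‖ ^ p) + fun _ => r ^ p) := rfl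
    rw [h5, h2, Pi.smul_apply, h3, Pi.add_apply, condExp_const (ℱ.le _), smul_eq_mul, hV]
    gcongr
  have hYp : ∀ m, k < m → Integrable (fun ω => ‖Y m ω‖ ^ p) P := fun m hm =>
    (hXZp m hm).mono' (hcont.comp_aestronglyMeasurable (hYae m hm))
      (Eventually.of_forall fun ω => by
        rw [Real.norm_of_nonneg (by positivity)]
        exact Real.rpow_le_rpow (norm_nonneg _) (norm_truncFactor_smul_le_norm _) (by linarith))
  have hYv : ∀ m, k < m →
      P[fun ω => ‖Y m ω‖ ^ p | ℱ (m - 1)] ≤ᵐ[P] fun _ => 2 ^ (p - 1) * V := by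
    intro m hm
    refine (condExp_mono (hYp m hm) (hXZp m hm) (Eventually.of_forall fun ω => ?_)).trans
      (hXZv m hm)
    exact Real.rpow_le_rpow (norm_nonneg _) (norm_truncFactor_smul_le_norm _) (by linarith)
  have hinc := fun m (hm : k < m) => sq_mul_condExp_exp_norm_le (ℱ.le (m - 1)) hβ hp2 hl
    (hYae m hm) (hYb m) (hYp m hm) (hYv m hm)
  have hbias : ∀ m, k < m → ∀ᵐ ω ∂P, ‖P[Y m | ℱ (m - 1)] ω - (μ - Z ω)‖ ≤
      constK p * lam ^ (p - 1) * (2 ^ (p - 1) * V) := by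
    intro m hm
    have hdi : Integrable (fun ω => Y m ω - (X m ω - Z ω)) P := (hYi m hm).sub (hXZi m hm)
    have hle : ∀ ω, ‖Y m ω - (X m ω - Z ω)‖ ≤
        ((constK p * lam ^ (p - 1)) • fun ω => ‖X m ω - Z ω‖ ^ p) ω := fun ω =>
      norm_truncFactor_smul_sub_le hp hl _
    filter_upwards [norm_condExp_le (μ := P) (m := ℱ (m - 1)) fun ω => Y m ω - (X m ω - Z ω),
      condExp_mono hdi.norm ((hXZp m hm).smul _) (Eventually.of_forall hle) (m := ℱ (m - 1)),
      condExp_smul (constK p * lam ^ (p - 1)) (fun ω => ‖X m ω - Z ω‖ ^ p) (ℱ (m - 1)),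
      hXZv m hm, condExp_sub (hYi m hm) (hXZi m hm) (ℱ (m - 1)),
      condExp_sub (hX.integrable m (by omega)) hZi (ℱ (m - 1)), hX.condMean m (by omega)]
      with ω h1 h2 h3 h4 h5 h6 h7
    have h8 : P[fun ω => Y m ω - (X m ω - Z ω) | ℱ (m - 1)] ω =
        P[Y m | ℱ (m - 1)] ω - (μ - Z ω) := by
      refine h5.trans ?_
      rw [Pi.sub_apply]
      congr 1
      refine h6.trans ?_
      rw [Pi.sub_apply, h7, condExp_of_stronglyMeasurable (ℱ.le _) (hZm m hm) hZi]
    rw [h8] at h1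
    refine h1.trans (h2.trans ?_)
    rw [h3, Pi.smul_apply, smul_eq_mul]
    have := (constK_pos hp).le
    gcongr
  -- The threshold exceeds L by N times the per-step growth c, so that the tail bound becomes
  -- exactly 2 exp (-L).
  have htail := h.measureReal_norm_sum_ge_le (ℱ := ℱ) (D := D) (k := k) (b := 2 * β⁻¹)
    (c := frakC E p β⁻¹ * lam ^ p * V) (P := P)
    (fun m hm => ((hYm m hm).sub (stronglyMeasurable_condExp.mono (ℱ.mono (by omega)))).const_smul _)
    (fun m hm => by
      filter_upwards [condExp_smul (lam / β) (Y m - P[Y m | ℱ (m - 1)]) (ℱ (m - 1)),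
        condExp_sub (hYi m hm) (integrable_condExp (f := Y m) (m := ℱ (m - 1))) (ℱ (m - 1))]
        with ω h1 h2
      refine h1.trans ?_
      rw [Pi.smul_apply, h2, Pi.sub_apply, condExp_of_stronglyMeasurable (ℱ.le _)
        stronglyMeasurable_condExp integrable_condExp]
      simp)
    (fun m hm => (hinc m hm).1) (by have := frakC_pos E p (inv_pos.2 hβ); positivity)
    (fun m hm => (hinc m hm).2) hkn.le (L + N * (frakC E p β⁻¹ * lam ^ p * V))
  rw [hNk, show N * (frakC E p β⁻¹ * lam ^ p * V) - (L + N * (frakC E p β⁻¹ * lam ^ p * V)) = -L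
    by ring] at htail
  refine le_trans ?_ htail
  refine ENNReal.toReal_mono (measure_ne_top _ _) (measure_mono_ae ?_)
  have hbias' : ∀ᵐ ω ∂P, ∀ m ∈ Finset.Ioc k n, ‖P[Y m | ℱ (m - 1)] ω - (μ - Z ω)‖ ≤
      constK p * lam ^ (p - 1) * (2 ^ (p - 1) * V) :=
    (Finset.eventually_all _).2 fun m hm => hbias m (Finset.mem_Ioc.1 hm).1
  filter_upwards [hbias'] with ω hω hbad
  change L + N * (frakC E p β⁻¹ * lam ^ p * V) ≤ ‖∑ m ∈ Finset.Ioc k n, D m ω‖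
  by_contra! hlt
  refine hbad ?_
  -- The error is the rescaled martingale plus the average of the conditional biases.
  have hsum : truncatedMean X Z lam k n ω - μ = N⁻¹ • ((β / lam) • ∑ m ∈ Finset.Ioc k n, D m ω +
      ∑ m ∈ Finset.Ioc k n, (P[Y m | ℱ (m - 1)] ω - (μ - Z ω))) := by
    have h1 : (β / lam) • ∑ m ∈ Finset.Ioc k n, D m ω =
        ∑ m ∈ Finset.Ioc k n, (Y m ω - P[Y m | ℱ (m - 1)] ω) := by
      rw [Finset.smul_sum]
      refine Finset.sum_congr rfl fun m _ => ?_
      rw [hD, smul_smul, div_mul_div_cancel₀ hl.ne', div_self hβ.ne', one_smul]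
    have h2 : μ = N⁻¹ • ∑ m ∈ Finset.Ioc k n, μ := by
      rw [Finset.sum_const, Nat.card_Ioc, ← Nat.cast_smul_eq_nsmul ℝ, hNk, smul_smul,
        inv_mul_cancel₀ hN0.ne', one_smul]
    rw [h1, ← Finset.sum_add_distrib]
    conv_lhs => rw [h2]
    rw [truncatedMean, ← hN, ← smul_sub, ← Finset.sum_sub_distrib]
    congr 1
    refine Finset.sum_congr rfl fun m _ => ?_
    rw [hY]
    abel
  have hb := norm_sum_le_of_le _ hω
  rw [Finset.sum_const, Nat.card_Ioc, nsmul_eq_mul, hNk] at hb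
  rw [hsum, norm_smul, Real.norm_of_nonneg (inv_nonneg.2 hN0.le)]
  have hlp : lam ^ p = lam ^ (p - 1) * lam := by
    rw [← Real.rpow_add_one hl.ne']; congr 1; ring
  calc _ ≤ N⁻¹ * (β / lam * (L + N * (frakC E p β⁻¹ * lam ^ p * V)) +
        N * (constK p * lam ^ (p - 1) * (2 ^ (p - 1) * V))) := by
        gcongr
        refine (norm_add_le _ _).trans (add_le_add ?_ hb)
        rw [norm_smul, Real.norm_of_nonneg (by positivity)]
        gcongr
    _ = _ := by
        rw [templateConst, hlp]
        field_simp
        ring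

/-- The concentration bound asks for a centre that is within r of μ everywhere. Replacing Z by μ
where ‖Z - μ‖ ≥ r preserves ℱ k-measurability and changes the estimator only on an event of
probability at most δ₂. -/
lemma IsHeavyTailedSequence.truncatedMean_optLam (h : IsTwoSmooth (fun x : E => ‖x‖) β)
    (hX : IsHeavyTailedSequence P ℱ X μ p v) (hp : 1 < p) (hp2 : p ≤ 2) (hv : 0 < v) (hβ : 0 < β)
    {δ₁ δ₂ : ℝ} (hδ₁ : 0 < δ₁) (hδ₁' : δ₁ < 1)
    (hr : 0 ≤ r) (hkn : k < n) (hZ : StronglyMeasurable[ℱ k] Z)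
    (hZr : P.real {ω | r ≤ ‖Z ω - μ‖} ≤ δ₂) :
    1 - (δ₁ + δ₂) ≤ P.real {ω | ‖truncatedMean X Z (optLam E p v β δ₁ r k n) k n ω - μ‖ ≤
      2 * (templateConst E p β * (v + r ^ p)) ^ (1 / p) *
        (β * Real.log (2 / δ₁) / ((n : ℝ) - k)) ^ ((p - 1) / p)} := by
  have hT := templateConst_pos E hp hβ
  have hL : 0 < Real.log (2 / δ₁) := Real.log_pos (by rw [lt_div_iff₀ hδ₁]; linarith)
  have hN : 0 < (n : ℝ) - k := by rw [sub_pos]; exact_mod_cast hkn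
  have hV : 0 < v + r ^ p := by have := Real.rpow_nonneg hr p; linarith
  have hb := optLam_bound hp hβ hT hV hL hN (lam := optLam E p v β δ₁ r k n) rfl
  have hl : 0 < optLam E p v β δ₁ r k n := by unfold optLam; positivity
  classical
  set A : Set Ω := {ω | ‖Z ω - μ‖ < r} with hA
  have hAm : MeasurableSet[ℱ k] A :=
    (hZ.sub stronglyMeasurable_const).norm.measurable measurableSet_Iio
  have hZ' : StronglyMeasurable[ℱ k] (A.piecewise Z fun _ => μ) :=
    hZ.piecewise hAm stronglyMeasurable_const
  have key := hX.measureReal_truncatedMean_le h hp hp2 hv hβ hr hl hkn hZ' (fun ω => by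
    by_cases hω : ω ∈ A
    · rw [Set.piecewise_eq_of_mem _ _ _ hω]; exact le_of_lt hω
    · rw [Set.piecewise_eq_of_notMem _ _ _ hω]; simpa using hr) (Real.log (2 / δ₁))
  rw [two_mul_exp_neg_log hδ₁, hb] at key
  set G := {ω | ‖truncatedMean X Z (optLam E p v β δ₁ r k n) k n ω - μ‖ ≤
      2 * (templateConst E p β * (v + r ^ p)) ^ (1 / p) *
        (β * Real.log (2 / δ₁) / ((n : ℝ) - k)) ^ ((p - 1) / p)}
  set G' := {ω | ¬ ‖truncatedMean X (A.piecewise Z fun _ => μ) (optLam E p v β δ₁ r k n) k n ω - μ‖ ≤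
      2 * (templateConst E p β * (v + r ^ p)) ^ (1 / p) *
        (β * Real.log (2 / δ₁) / ((n : ℝ) - k)) ^ ((p - 1) / p)}
  have hcover : Set.univ ⊆ G ∪ (G' ∪ {ω | r ≤ ‖Z ω - μ‖}) := by
    intro ω _
    by_cases hω : ω ∈ A
    · by_cases hG : ω ∈ G
      · exact Or.inl hG
      · refine Or.inr (Or.inl ?_)
        simp only [G', G, Set.mem_ofPred_eq, truncatedMean] at hG ⊢
        rwa [Set.piecewise_eq_of_mem _ _ _ hω]
    · exact Or.inr (Or.inr (Set.mem_ofPred_eq ▸ not_lt.1 hω))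
  have h1 := measureReal_mono (μ := P) hcover
  have h2 := measureReal_union_le (μ := P) G (G' ∪ {ω | r ≤ ‖Z ω - μ‖})
  have h3 := measureReal_union_le (μ := P) G' {ω | r ≤ ‖Z ω - μ‖}
  rw [probReal_univ] at h1
  linarith

end TruncatedMean

/-! ### Moment and Chernoff bounds for the initial estimates -/

section InitialEstimates

variable {E Ω : Type*} [NormedAddCommGroup E] [NormedSpace ℝ E]
  [CompleteSpace E] {mΩ : MeasurableSpace Ω} {P : Measure Ω} [IsProbabilityMeasure P]
  {β p v s : ℝ} {ℱ : Filtration ℕ mΩ} {X : ℕ → Ω → E} {μ : E} {a b : ℕ}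

namespace IsHeavyTailedSequence

/-- The weight is moved inside the norm as W^(1/p). Being ℱ a-measurable, it keeps the increments
after time a martingale differences, so the unconditional inequality applies to them. Arbitrary
weights W serve as a substitute for conditioning on ℱ a. -/
lemma integral_mul_norm_sum_rpow_le (h : IsTwoSmooth (fun x : E => ‖x‖) β)
    (hX : IsHeavyTailedSequence P ℱ X μ p v) (hp : 1 < p) (hp2 : p ≤ 2) (hβ : 0 < β)
    (hab : a ≤ b) {W : Ω → ℝ} (hW : StronglyMeasurable[ℱ a] W) {C : ℝ}
    (hW0 : ∀ ω, 0 ≤ W ω) (hWC : ∀ ω, W ω ≤ C) :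
    Integrable (fun ω => W ω * ‖∑ m ∈ Finset.Ioc a b, (X m ω - μ)‖ ^ p) P ∧
      ∫ ω, W ω * ‖∑ m ∈ Finset.Ioc a b, (X m ω - μ)‖ ^ p ∂P ≤
        2 * β ^ p * (v * ((b : ℝ) - a)) * ∫ ω, W ω ∂P := by
  have hp0 : 0 < p := by linarith
  set g : Ω → ℝ := fun ω => W ω ^ p⁻¹ with hg
  have hg0 : ∀ ω, 0 ≤ g ω := fun ω => Real.rpow_nonneg (hW0 ω) _
  have hgp : ∀ ω, g ω ^ p = W ω := fun ω => Real.rpow_inv_rpow (hW0 ω) hp0.ne'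
  have hgm : StronglyMeasurable[ℱ a] g :=
    (Real.continuous_rpow_const (inv_nonneg.2 hp0.le)).comp_stronglyMeasurable hW
  have hWi : Integrable W P := Integrable.of_bound (hW.mono (ℱ.le a)).aestronglyMeasurable C
    (Eventually.of_forall fun ω => by rw [Real.norm_of_nonneg (hW0 ω)]; exact hWC ω)
  have hnorm : ∀ ω (x : E), ‖g ω • x‖ ^ p = W ω * ‖x‖ ^ p := fun ω x => by
    rw [norm_smul, Real.norm_of_nonneg (hg0 ω), Real.mul_rpow (hg0 ω) (norm_nonneg _), hgp]
  have hdi : ∀ m, a < m → Integrable (fun ω => X m ω - μ) P := fun m hm =>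
    (hX.integrable m (by omega)).sub (integrable_const _)
  have hDi : ∀ m, a < m → Integrable (fun ω => g ω • (X m ω - μ)) P := fun m hm =>
    (hdi m hm).bdd_smul (C ^ p⁻¹) (hgm.mono (ℱ.le a)).aestronglyMeasurable
      (Eventually.of_forall fun ω => by
        rw [Real.norm_of_nonneg (hg0 ω)]
        exact Real.rpow_le_rpow (hW0 ω) (hWC ω) (inv_nonneg.2 hp0.le))
  have hWp : ∀ m, a < m → Integrable (fun ω => W ω * ‖X m ω - μ‖ ^ p) P := fun m hm =>
    (hX.integrable_moment m (by omega)).bdd_mul (c := C)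
      (hW.mono (ℱ.le a)).aestronglyMeasurable (Eventually.of_forall fun ω => by
        rw [Real.norm_of_nonneg (hW0 ω)]; exact hWC ω)
  have key := h.integral_norm_sum_rpow_le (P := P) hβ hp hp2 (ℱ := ℱ) (k := a) (n := b)
    (D := fun m ω => g ω • (X m ω - μ))
    (fun m hm => (hgm.mono (ℱ.mono hm.le)).smul
      ((hX.adapted m (by omega)).sub stronglyMeasurable_const)) hDi
    (fun m hm => by
      filter_upwards [condExp_smul_of_aestronglyMeasurable_left (m := ℱ (m - 1))
        (hgm.mono (ℱ.mono (by omega))).aestronglyMeasurable (hDi m hm) (hdi m hm),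
        condExp_sub (hX.integrable m (by omega)) (integrable_const μ) (ℱ (m - 1)),
        hX.condMean m (by omega)] with ω h1 h2 h3
      refine h1.trans ?_
      have h4 : P[fun ω => X m ω - μ | ℱ (m - 1)] ω = 0 := by
        refine h2.trans ?_
        rw [Pi.sub_apply, h3, condExp_const (ℱ.le _), sub_self]
      rw [Pi.smul_apply', h4, smul_zero, Pi.zero_apply])
    (fun m hm => by simpa only [hnorm] using hWp m hm) hab
  simp only [← Finset.smul_sum, hnorm] at key
  refine ⟨key.1, key.2.trans ?_⟩
  rw [mul_assoc _ (v * _)]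
  gcongr
  have hterm : ∀ m ∈ Finset.Ioc a b, ∫ ω, W ω * ‖X m ω - μ‖ ^ p ∂P ≤ v * ∫ ω, W ω ∂P := by
    intro m hm
    have hm := (Finset.mem_Ioc.1 hm).1
    have hpull := condExp_mul_of_stronglyMeasurable_left (hW.mono (ℱ.mono (by omega : a ≤ m - 1)))
      (hWp m hm) (hX.integrable_moment m (by omega))
    rw [← integral_condExp (ℱ.le (m - 1)), ← integral_const_mul]
    refine integral_mono_ae integrable_condExp (hWi.const_mul v) ?_
    filter_upwards [hpull, hX.condMoment m (by omega)] with ω h1 h2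
    refine h1.le.trans ?_
    rw [Pi.mul_apply, mul_comm v]
    exact mul_le_mul_of_nonneg_left h2 (hW0 ω)
  refine (Finset.sum_le_sum hterm).trans (le_of_eq ?_)
  rw [Finset.sum_const, Nat.card_Ioc, nsmul_eq_mul, Nat.cast_sub hab]
  ring

/-- A weighted form of the conditional Markov inequality for block means. -/
lemma integral_mul_indicator_le (h : IsTwoSmooth (fun x : E => ‖x‖) β)
    (hX : IsHeavyTailedSequence P ℱ X μ p v) (hp : 1 < p) (hp2 : p ≤ 2) (hβ : 0 < β)
    (hab : a < b) {W : Ω → ℝ} (hW : StronglyMeasurable[ℱ a] W) {C : ℝ}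
    (hW0 : ∀ ω, 0 ≤ W ω) (hWC : ∀ ω, W ω ≤ C) (hs : 0 < s) :
    ∫ ω, W ω * Set.indicator {ω | s ≤ ‖((b : ℝ) - a)⁻¹ • ∑ m ∈ Finset.Ioc a b, X m ω - μ‖} 1 ω ∂P ≤
      2 * β ^ p * v / (((b : ℝ) - a) ^ (p - 1) * s ^ p) * ∫ ω, W ω ∂P := by
  obtain ⟨hi, hle⟩ := hX.integral_mul_norm_sum_rpow_le h hp hp2 hβ hab.le hW hW0 hWC
  set N : ℝ := (b : ℝ) - a with hN
  have hN0 : 0 < N := by rw [hN, sub_pos]; exact_mod_cast hab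
  have hpt : ∀ ω, W ω * Set.indicator {ω | s ≤ ‖N⁻¹ • ∑ m ∈ Finset.Ioc a b, X m ω - μ‖} 1 ω ≤
      ((N * s) ^ p)⁻¹ * (W ω * ‖∑ m ∈ Finset.Ioc a b, (X m ω - μ)‖ ^ p) := by
    intro ω
    by_cases hω : s ≤ ‖N⁻¹ • ∑ m ∈ Finset.Ioc a b, X m ω - μ‖
    · rw [Set.indicator_of_mem (by exact hω)]
      have h1 : ∑ m ∈ Finset.Ioc a b, (X m ω - μ) =
          N • (N⁻¹ • ∑ m ∈ Finset.Ioc a b, X m ω - μ) := by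
        rw [smul_sub, smul_inv_smul₀ hN0.ne', Finset.sum_sub_distrib, Finset.sum_const,
          Nat.card_Ioc, ← Nat.cast_smul_eq_nsmul ℝ, Nat.cast_sub hab.le]
      have h2 : (N * s) ^ p ≤ ‖∑ m ∈ Finset.Ioc a b, (X m ω - μ)‖ ^ p := by
        rw [h1, norm_smul, Real.norm_of_nonneg hN0.le]
        gcongr
      have h3 : 0 < (N * s) ^ p := by positivity
      rw [Pi.one_apply, mul_one, inv_mul_eq_div, le_div_iff₀ h3]
      exact mul_le_mul_of_nonneg_left h2 (hW0 ω)
    · rw [Set.indicator_of_notMem (by exact hω), mul_zero]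
      have := hW0 ω
      positivity
  have h1 := integral_mono_of_nonneg (μ := P) (Eventually.of_forall fun ω =>
    mul_nonneg (hW0 ω) (Set.indicator_nonneg (fun _ _ => zero_le_one) ω)) (hi.const_mul _)
    (Eventually.of_forall hpt)
  refine h1.trans ?_
  rw [integral_const_mul]
  have hNp : N ^ p = N ^ (p - 1) * N := by
    rw [← Real.rpow_add_one hN0.ne']; congr 1; ring
  calc _ ≤ ((N * s) ^ p)⁻¹ * (2 * β ^ p * (v * N) * ∫ ω, W ω ∂P) := by gcongr
    _ = _ := by
      rw [Real.mul_rpow hN0.le hs.le, hNp]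
      field_simp

lemma measureReal_empiricalMean_le (h : IsTwoSmooth (fun x : E => ‖x‖) β)
    (hX : IsHeavyTailedSequence P ℱ X μ p v) (hp : 1 < p) (hp2 : p ≤ 2) (hβ : 0 < β) {k : ℕ}
    (hk : 1 ≤ k) (hs : 0 < s) :
    P.real {ω | s ≤ ‖empiricalMean X k ω - μ‖} ≤ 2 * β ^ p * v / ((k : ℝ) ^ (p - 1) * s ^ p) := by
  have h1 := hX.integral_mul_indicator_le h hp hp2 hβ (a := 0) (b := k) (by omega)
    (W := fun _ => 1) stronglyMeasurable_const (C := 1) (fun _ => zero_le_one) (fun _ => le_rfl) hs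
  have hmeas : MeasurableSet {ω | s ≤ ‖empiricalMean X k ω - μ‖} := by
    have : StronglyMeasurable (fun ω => empiricalMean X k ω - μ) :=
      ((Finset.stronglyMeasurable_fun_sum _ fun m hm => (hX.adapted m
        (Finset.mem_Icc.1 hm).1).mono (ℱ.le m)).const_smul _).sub stronglyMeasurable_const
    exact this.norm.measurable measurableSet_Ici
  have hset : {ω | s ≤ ‖(((k : ℕ) : ℝ) - ((0 : ℕ) : ℝ))⁻¹ • ∑ m ∈ Finset.Ioc 0 k, X m ω - μ‖} =
      {ω | s ≤ ‖empiricalMean X k ω - μ‖} := by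
    simp only [empiricalMean, Nat.cast_zero, sub_zero]
    rfl
  rw [hset] at h1
  simp only [one_mul, Nat.cast_zero, sub_zero, integral_const, probReal_univ, one_smul,
    mul_one] at h1
  rwa [integral_indicator_one hmeas] at h1

variable {N : ℕ}

lemma stronglyMeasurable_blockMean {P : Measure Ω}
    (hX : IsHeavyTailedSequence P ℱ X μ p v) (j : ℕ) :
    StronglyMeasurable[ℱ ((j + 1) * N)] (blockMean X N j) := by
  refine (Finset.stronglyMeasurable_fun_sum _ fun m hm => ?_).const_smul _
  rw [Finset.mem_Ioc] at hm
  exact (hX.adapted m (by omega)).mono (ℱ.mono hm.2)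

lemma stronglyMeasurable_exp_sum_indicator {P : Measure Ω}
    (hX : IsHeavyTailedSequence P ℱ X μ p v) (θ : ℝ) (j : ℕ) :
    StronglyMeasurable[ℱ (j * N)] (fun ω => Real.exp (θ * ∑ b ∈ Finset.range j,
      Set.indicator {ω | s ≤ ‖blockMean X N b ω - μ‖} 1 ω)) := by
  refine Real.continuous_exp.comp_stronglyMeasurable (StronglyMeasurable.const_mul ?_ θ)
  refine Finset.stronglyMeasurable_fun_sum _ fun b hb => ?_
  have hb : (b + 1) * N ≤ j * N := Nat.mul_le_mul_right _ (Finset.mem_range.1 hb)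
  have h1 : StronglyMeasurable[ℱ (j * N)] (fun ω => blockMean X N b ω - μ) :=
    ((hX.stronglyMeasurable_blockMean b).mono (ℱ.mono hb)).sub stronglyMeasurable_const
  exact stronglyMeasurable_one.indicator (h1.norm.measurable measurableSet_Ici)

/-- The exponential moment of the number of block means that are far from the mean. -/
lemma integral_exp_sum_indicator_le (h : IsTwoSmooth (fun x : E => ‖x‖) β)
    (hX : IsHeavyTailedSequence P ℱ X μ p v) (hp : 1 < p) (hp2 : p ≤ 2) (hβ : 0 < β)
    (hN : 0 < N) (hs : 0 < s) {γ θ : ℝ} (hθ : 0 ≤ θ)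
    (hγ : 2 * β ^ p * v / ((N : ℝ) ^ (p - 1) * s ^ p) ≤ γ) (hγ0 : 0 ≤ γ) (j : ℕ) :
    ∫ ω, Real.exp (θ * ∑ b ∈ Finset.range j,
      Set.indicator {ω | s ≤ ‖blockMean X N b ω - μ‖} 1 ω) ∂P ≤
      (1 + γ * (Real.exp θ - 1)) ^ j := by
  have hθ1 : 0 ≤ Real.exp θ - 1 := by linarith [Real.one_le_exp hθ]
  induction j with
  | zero => simp
  | succ j ih =>
    set W : Ω → ℝ := fun ω => Real.exp (θ * ∑ b ∈ Finset.range j,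
      Set.indicator {ω | s ≤ ‖blockMean X N b ω - μ‖} 1 ω) with hW
    have hWm : StronglyMeasurable[ℱ (j * N)] W := hX.stronglyMeasurable_exp_sum_indicator θ j
    have hW0 : ∀ ω, 0 ≤ W ω := fun ω => (Real.exp_pos _).le
    have hWC : ∀ ω, W ω ≤ Real.exp (θ * j) := by
      intro ω
      refine Real.exp_le_exp.2 (mul_le_mul_of_nonneg_left ?_ hθ)
      calc _ ≤ ∑ b ∈ Finset.range j, (1 : ℝ) := Finset.sum_le_sum fun b _ =>
            Set.indicator_le_self' (fun _ _ => zero_le_one) ω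
        _ = j := by simp
    have hWi : Integrable W P := Integrable.of_bound (hWm.mono (ℱ.le _)).aestronglyMeasurable _
      (Eventually.of_forall fun ω => by rw [Real.norm_of_nonneg (hW0 ω)]; exact hWC ω)
    have h1 := hX.integral_mul_indicator_le h hp hp2 hβ (a := j * N) (b := (j + 1) * N)
      (by nlinarith) hWm hW0 hWC hs
    have hcast : (((j + 1) * N : ℕ) : ℝ) - ((j * N : ℕ) : ℝ) = N := by push_cast; ring
    rw [hcast] at h1
    change ∫ ω, W ω * Set.indicator {ω | s ≤ ‖blockMean X N j ω - μ‖} 1 ω ∂P ≤ _ at h1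
    have hWint : 0 ≤ ∫ ω, W ω ∂P := integral_nonneg hW0
    have h2 : ∫ ω, W ω * Set.indicator {ω | s ≤ ‖blockMean X N j ω - μ‖} 1 ω ∂P ≤
        γ * ∫ ω, W ω ∂P := h1.trans (by gcongr)
    have hGm : MeasurableSet {ω | s ≤ ‖blockMean X N j ω - μ‖} :=
      (((hX.stronglyMeasurable_blockMean j).mono (ℱ.le _)).sub
        stronglyMeasurable_const).norm.measurable measurableSet_Ici
    have hWGi : Integrable
        (fun ω => W ω * Set.indicator {ω | s ≤ ‖blockMean X N j ω - μ‖} 1 ω) P := by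
      refine hWi.mono' ((hWm.mono (ℱ.le _)).mul
        (stronglyMeasurable_one.indicator hGm)).aestronglyMeasurable
        (Eventually.of_forall fun ω => ?_)
      rw [norm_mul, Real.norm_of_nonneg (hW0 ω)]
      refine mul_le_of_le_one_right (hW0 ω) ?_
      refine (norm_indicator_le_norm_self _ _).trans ?_
      simp
    -- For an indicator, exp (θ 1_G) = 1 + (exp θ - 1) 1_G. The past exponential W is then the
    -- weight in the Markov bound for the next block.
    have h3 : ∀ ω, Real.exp (θ * ∑ b ∈ Finset.range (j + 1),
        Set.indicator {ω | s ≤ ‖blockMean X N b ω - μ‖} 1 ω) =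
        W ω + (Real.exp θ - 1) *
          (W ω * Set.indicator {ω | s ≤ ‖blockMean X N j ω - μ‖} 1 ω) := by
      intro ω
      rw [Finset.sum_range_succ, mul_add, Real.exp_add]
      by_cases hω : s ≤ ‖blockMean X N j ω - μ‖
      · rw [Set.indicator_of_mem (s := {ω | s ≤ ‖blockMean X N j ω - μ‖}) (by exact hω)]
        simp only [Pi.one_apply, mul_one, hW]
        ring
      · rw [Set.indicator_of_notMem (s := {ω | s ≤ ‖blockMean X N j ω - μ‖}) (by exact hω)]
        simp [hW]
    simp_rw [h3]
    rw [integral_add hWi (hWGi.const_mul _), integral_const_mul, pow_succ]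
    calc _ ≤ ∫ ω, W ω ∂P + (Real.exp θ - 1) * (γ * ∫ ω, W ω ∂P) := by gcongr
      _ = (∫ ω, W ω ∂P) * (1 + γ * (Real.exp θ - 1)) := by ring
      _ ≤ _ := by gcongr

lemma measureReal_sum_indicator_ge_le (h : IsTwoSmooth (fun x : E => ‖x‖) β)
    (hX : IsHeavyTailedSequence P ℱ X μ p v) (hp : 1 < p) (hp2 : p ≤ 2) (hβ : 0 < β)
    (hN : 0 < N) (hs : 0 < s)
    (hγ : 2 * β ^ p * v / ((N : ℝ) ^ (p - 1) * s ^ p) ≤ 1 / 10) (B : ℕ) :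
    P.real {ω | (7 / 18 : ℝ) * B ≤ ∑ b ∈ Finset.range B,
      Set.indicator {ω | s ≤ ‖blockMean X N b ω - μ‖} 1 ω} ≤
      Real.exp (-(B * momPsi (7 / 18) (1 / 10))) := by
  -- The optimal Chernoff parameter log (α(1 - γ) / ((1 - α)γ)) for α = 7/18, γ = 1/10. It gives 1 +
  -- γ(exp θ - 1) = 81/55.
  set θ : ℝ := Real.log (63 / 11) with hθ
  have hθ0 : 0 ≤ θ := Real.log_nonneg (by norm_num)
  have hle := hX.integral_exp_sum_indicator_le h hp hp2 hβ hN hs hθ0 hγ (by norm_num) B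
  have hi : Integrable (fun ω => Real.exp (θ * ∑ b ∈ Finset.range B,
      Set.indicator {ω | s ≤ ‖blockMean X N b ω - μ‖} 1 ω)) P := by
    refine Integrable.of_bound ((hX.stronglyMeasurable_exp_sum_indicator θ B).mono
      (ℱ.le _)).aestronglyMeasurable (Real.exp (θ * B)) (Eventually.of_forall fun ω => ?_)
    rw [Real.norm_of_nonneg (Real.exp_pos _).le]
    gcongr
    calc _ ≤ ∑ b ∈ Finset.range B, (1 : ℝ) := Finset.sum_le_sum fun b _ =>
          Set.indicator_le_self' (fun _ _ => zero_le_one) ω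
      _ = B := by simp
  have h1 := mul_meas_ge_le_integral_of_nonneg (μ := P)
    (Eventually.of_forall fun ω => (Real.exp_pos _).le) hi (Real.exp (θ * (7 / 18 * B)))
  have h2 : P.real {ω | (7 / 18 : ℝ) * B ≤ ∑ b ∈ Finset.range B,
      Set.indicator {ω | s ≤ ‖blockMean X N b ω - μ‖} 1 ω} ≤
      P.real {ω | Real.exp (θ * (7 / 18 * B)) ≤ Real.exp (θ * ∑ b ∈ Finset.range B,
        Set.indicator {ω | s ≤ ‖blockMean X N b ω - μ‖} 1 ω)} := by
    refine measureReal_mono fun ω hω => ?_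
    simp only [Set.mem_ofPred_eq] at hω ⊢
    gcongr
  have h3 : (1 + 1 / 10 * (Real.exp θ - 1)) ^ B = Real.exp (B * Real.log (81 / 55)) := by
    rw [Real.exp_nat_mul, hθ, Real.exp_log (by norm_num), Real.exp_log (by norm_num)]
    norm_num
  have h4 : momPsi (7 / 18) (1 / 10) = 7 / 18 * θ - Real.log (81 / 55) := by
    have e1 : Real.log (81 / 55) = -Real.log (55 / 81) := by rw [← Real.log_inv]; norm_num
    have e2 : Real.log (35 / 9) = θ + Real.log (55 / 81) := by
      rw [hθ, ← Real.log_mul (by norm_num) (by norm_num)]; norm_num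
    rw [momPsi, e1]
    norm_num
    rw [e2]
    ring
  rw [h3] at hle
  have h5 := (mul_le_mul_of_nonneg_left h2 (Real.exp_pos (θ * (7 / 18 * B))).le).trans
    (h1.trans hle)
  rw [h4, show -(B * (7 / 18 * θ - Real.log (81 / 55))) =
    B * Real.log (81 / 55) - θ * (7 / 18 * B) by ring, Real.exp_sub,
    le_div_iff₀ (Real.exp_pos _), mul_comm]
  exact h5

end IsHeavyTailedSequence

end InitialEstimates

/-! ### Radii, error terms and constants -/

lemma rpow_one_div_rpow {x p : ℝ} (hx : 0 ≤ x) (hp : 0 < p) : (x ^ (1 / p)) ^ p = x := by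
  rw [one_div, Real.rpow_inv_rpow hx hp.ne']

lemma meanRadius_rpow {p v β δ : ℝ} (hp : 0 < p) (hv : 0 ≤ v) (hβ : 0 ≤ β) (hδ : 0 ≤ δ) (k : ℕ) :
    meanRadius p v β δ k ^ p = v * meanErr p β δ k := by
  have hk : (0 : ℝ) ≤ k := Nat.cast_nonneg k
  rw [meanRadius, meanErr, Real.div_rpow (by positivity) (by positivity),
    Real.mul_rpow (by positivity) (by positivity), Real.mul_rpow (by positivity) hβ,
    Real.mul_rpow (by positivity) (by positivity), rpow_one_div_rpow hv hp,
    rpow_one_div_rpow hδ hp, ← Real.rpow_mul hk, div_mul_cancel₀ _ hp.ne']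
  ring

lemma momRadius_rpow {p v β δ : ℝ} (hp : 0 < p) (hv : 0 ≤ v) (hβ : 0 ≤ β)
    (hδ : 0 ≤ Real.log (1 / δ)) (k : ℕ) :
    momRadius p v β δ k ^ p = v * momErr p β δ k := by
  have hc : 0 ≤ (3.5 * Real.log (1 / δ) + 1) / momUsed δ k := by positivity
  rw [momRadius, momErr, Real.mul_rpow (by positivity) (by positivity),
    Real.mul_rpow (by positivity) (by positivity), Real.div_rpow (by positivity) (by positivity),
    Real.mul_rpow (by positivity) hβ, rpow_one_div_rpow hv hp, rpow_one_div_rpow (by norm_num) hp,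
    ← Real.rpow_mul hc, sub_mul, one_mul, div_mul_cancel₀ _ hp.ne']
  ring

lemma momBlocks_pos (δ : ℝ) : 0 < momBlocks δ := Nat.succ_pos _

lemma momBlocks_le {δ : ℝ} (hδ : 0 ≤ Real.log (1 / δ)) :
    (momBlocks δ : ℝ) ≤ 3.5 * Real.log (1 / δ) + 1 := by
  have hψ := two_div_seven_le_momPsi
  have h1 : Real.log (1 / δ) / momPsi (7 / 18) (1 / 10) ≤ 3.5 * Real.log (1 / δ) := by
    rw [div_le_iff₀ (by linarith)]
    nlinarith
  have h2 := Nat.floor_le (a := Real.log (1 / δ) / momPsi (7 / 18) (1 / 10))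
    (div_nonneg hδ (by linarith))
  rw [momBlocks]
  push_cast
  linarith

/-- The `+ 1` after the floor puts the number of blocks above log (1/δ) / ψ. -/
lemma exp_neg_momBlocks_le {δ : ℝ} (hδ : 0 < δ) :
    Real.exp (-(momBlocks δ * momPsi (7 / 18) (1 / 10))) ≤ δ := by
  have hψ : 0 < momPsi (7 / 18) (1 / 10) := by linarith [two_div_seven_le_momPsi]
  have h1 := Nat.lt_floor_add_one (Real.log (1 / δ) / momPsi (7 / 18) (1 / 10))
  rw [div_lt_iff₀ hψ] at h1
  rw [← Real.le_log_iff_exp_le hδ, momBlocks]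
  rw [one_div, Real.log_inv] at h1 ⊢
  push_cast
  linarith

lemma momUsed_pos {δ : ℝ} {k : ℕ} (hk : momBlocks δ ≤ k) : 0 < momUsed δ k :=
  Nat.mul_pos (momBlocks_pos δ) (Nat.div_pos hk (momBlocks_pos δ))

lemma lt_momUsed_add (δ : ℝ) (k : ℕ) : k < momUsed δ k + momBlocks δ := by
  have := Nat.lt_mul_div_succ k (momBlocks_pos δ)
  rw [momUsed]
  linarith

lemma momErr_le {p β δ : ℝ} (hp : 1 < p) (hp2 : p ≤ 2) (hβ : 0 < β) (hδ : 0 ≤ Real.log (1 / δ))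
    {k : ℕ} (hk : momBlocks δ ≤ k) :
    momErr p β δ k ≤ 8470 * (β ^ p * ((1 + Real.log (1 / δ)) / k) ^ (p - 1)) := by
  have hu : (0 : ℝ) < momUsed δ k := by exact_mod_cast momUsed_pos hk
  have hk0 : (0 : ℝ) < k := by exact_mod_cast (momBlocks_pos δ).trans_le hk
  -- Fewer than `momBlocks δ` observations are discarded, and at least that many are used.
  have h1 : (k : ℝ) ≤ 2 * momUsed δ k := by
    have h2 : momBlocks δ ≤ momUsed δ k :=
      Nat.le_mul_of_pos_right _ (Nat.div_pos hk (momBlocks_pos δ))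
    have h3 := lt_momUsed_add δ k
    exact_mod_cast (by omega : k ≤ 2 * momUsed δ k)
  set l := Real.log (1 / δ)
  have h4 : (3.5 * l + 1) / momUsed δ k ≤ 7 * ((1 + l) / k) := by
    rw [← mul_div_assoc, div_le_div_iff₀ hu hk0]
    calc (3.5 * l + 1) * k ≤ (3.5 * (1 + l)) * (2 * momUsed δ k) := by gcongr; linarith
      _ = _ := by ring
  have h5 : (7 : ℝ) ^ (p - 1) ≤ 7 := by
    simpa using Real.rpow_le_rpow_of_exponent_le (by norm_num : (1 : ℝ) ≤ 7)
      (by linarith : p - 1 ≤ 1)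
  have h6 : (11 : ℝ) ^ p ≤ 121 := by
    have := Real.rpow_le_rpow_of_exponent_le (by norm_num : (1 : ℝ) ≤ 11) hp2
    norm_num at this
    exact this
  rw [momErr]
  calc _ ≤ 121 * β ^ p / (1 / 10) * (7 * ((1 + l) / k)) ^ (p - 1) := by gcongr
    _ = 1210 * (β ^ p * (7 ^ (p - 1) * ((1 + l) / k) ^ (p - 1))) := by
      rw [Real.mul_rpow (by norm_num) (by positivity)]; ring
    _ ≤ 1210 * (β ^ p * (7 * ((1 + l) / k) ^ (p - 1))) := by gcongr
    _ = _ := by ring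

lemma meanErr_le {p β δ : ℝ} (hp2 : p ≤ 2) (hβ : 0 < β) (hδ : 0 < δ) (k : ℕ) :
    meanErr p β δ k ≤ 4 * (β ^ p / (δ * (k : ℝ) ^ (p - 1))) := by
  have h6 : (2 : ℝ) ^ p ≤ 4 := by
    have := Real.rpow_le_rpow_of_exponent_le (by norm_num : (1 : ℝ) ≤ 2) hp2
    norm_num at this
    exact this
  rw [meanErr, ← mul_div_assoc]
  gcongr

lemma tendsto_meanErr {p β δ : ℝ} (hp : 1 < p) (hδ : 0 < δ) :
    Tendsto (fun k : ℕ => meanErr p β δ k) atTop (𝓝 0) := by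
  have h1 : Tendsto (fun k : ℕ => (k : ℝ) ^ (p - 1)) atTop atTop :=
    (tendsto_rpow_atTop (by linarith)).comp tendsto_natCast_atTop_atTop
  exact (h1.const_mul_atTop hδ).const_div_atTop _

lemma tendsto_momErr {p β δ : ℝ} (hp : 1 < p) :
    Tendsto (fun k : ℕ => momErr p β δ k) atTop (𝓝 0) := by
  have h1 : Tendsto (fun k : ℕ => (momUsed δ k : ℝ)) atTop atTop := by
    refine tendsto_natCast_atTop_atTop.comp ?_
    refine tendsto_atTop_mono (f := fun k => k - momBlocks δ) (fun k => ?_)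
      (tendsto_sub_atTop_nat _)
    have := lt_momUsed_add δ k
    omega
  have h2 := (h1.const_div_atTop (3.5 * Real.log (1 / δ) + 1)).rpow_const
    (p := p - 1) (Or.inr (by linarith))
  rw [Real.zero_rpow (by linarith)] at h2
  simpa [momErr] using h2.const_mul (11 ^ p * β ^ p / (1 / 10))

/-- As `templateConst` is β times `leadConst`, the two factors carry β^(1/p) and β^((p-1)/p), whose
product is β. -/
lemma bound_eq_leadConst (E : Type*) [NormedAddCommGroup E] [NormedSpace ℝ E]
    {p β v ε L N : ℝ} (hp : 1 < p) (hβ : 0 < β) (hv : 0 < v) (hε : 0 ≤ ε)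
    (hL : 0 ≤ L) (hN : 0 < N) :
    2 * (templateConst E p β * (v + v * ε)) ^ (1 / p) * (β * L / N) ^ ((p - 1) / p) =
      2 * β * (v * leadConst E p β) ^ (1 / p) * (1 + ε) ^ (1 / p) * (L / N) ^ ((p - 1) / p) := by
  have h1 : templateConst E p β = β * leadConst E p β := by
    unfold templateConst leadConst; field_simp
  have h2 : 0 < leadConst E p β := by
    have := templateConst_pos E hp hβ
    rw [h1] at this
    exact pos_of_mul_pos_right this hβ.le
  have h3 : β = β ^ (1 / p) * β ^ ((p - 1) / p) := by
    rw [← Real.rpow_add hβ, ← add_div, add_sub_cancel, div_self (by linarith), Real.rpow_one]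
  rw [h1]
  generalize leadConst E p β = l at h2
  rw [show β * l * (v + v * ε) = β * ((v * l) * (1 + ε)) by ring,
    mul_div_assoc, Real.mul_rpow hβ.le (by positivity), Real.mul_rpow (by positivity)
    (by positivity), Real.mul_rpow hβ.le (by positivity)]
  conv_rhs => rw [h3]
  ring

/-- Since 2 / β ≤ 2, the exponential quotient is at most (e² - 3)/4 ≤ 9/8. With powers of 2 up to 8
and K_p ≤ 1 the total is at most 9β + 2. -/
lemma templateConst_le (E : Type*) [NormedAddCommGroup E] [NormedSpace ℝ E] {p β : ℝ}
    (hp : 1 < p) (hp2 : p ≤ 2) (hβ : 1 ≤ β) : templateConst E p β ≤ 11 * β := by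
  have hβ0 : 0 < β := by linarith
  have h1 : (Real.exp (2 * β⁻¹) - 2 * β⁻¹ - 1) / (2 * β⁻¹) ^ 2 ≤ 9 / 8 := by
    have h2 := exp_sub_one_sub_le_sq_mul (x := 2 * β⁻¹) (a := 2) (by positivity)
      (by have := inv_le_one_of_one_le₀ hβ; linarith) (by norm_num)
    have h3 : Real.exp 2 ≤ 7.5 := by
      have := Real.exp_one_lt_d9
      rw [show (2 : ℝ) = 1 + 1 by norm_num, Real.exp_add]
      nlinarith [Real.exp_pos 1]
    rw [div_le_iff₀ (by positivity)]
    have h4 : 0 ≤ (2 * β⁻¹) ^ 2 := by positivity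
    rw [div_pow] at h2
    nlinarith
  have h5 : 0 ≤ (Real.exp (2 * β⁻¹) - 2 * β⁻¹ - 1) / (2 * β⁻¹) ^ 2 := by
    have := exp_sub_one_sub_nonneg (2 * β⁻¹)
    exact div_nonneg (by linarith) (by positivity)
  have h6 : frakC E p β⁻¹ ≤ 9 := by
    have h7 : ∀ q : ℝ, q ≤ 3 → (2 : ℝ) ^ q ≤ 8 := fun q hq => by
      have := Real.rpow_le_rpow_of_exponent_le (by norm_num : (1 : ℝ) ≤ 2) hq
      norm_num at this
      exact this
    have h8 (q : Prop) [Decidable q] :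
        (if q then (2 : ℝ) ^ (p - 1) else (2 : ℝ) ^ (p + 1)) ≤ 8 := by
      split_ifs
      · exact h7 _ (by linarith)
      · exact h7 _ (by linarith)
    classical
    unfold frakC
    calc _ ≤ (8 : ℝ) * (9 / 8) := mul_le_mul (h8 _) h1 h5 (by norm_num)
      _ = 9 := by norm_num
  have h9 : constK p ≤ 1 := by
    have h10 : 0 ≤ (p - 1) / p := div_nonneg (by linarith) (by linarith)
    have h11 : ((p - 1) / p) ^ (p - 1) ≤ 1 :=
      Real.rpow_le_one h10 ((div_le_one (by linarith)).2 (by linarith)) (by linarith)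
    have h12 : 1 / p ≤ 1 := (div_le_one (by linarith)).2 hp.le
    exact mul_le_one₀ h12 (by positivity) h11
  have h13 : (2 : ℝ) ^ (p - 1) ≤ 2 := by
    simpa using Real.rpow_le_rpow_of_exponent_le (by norm_num : (1 : ℝ) ≤ 2)
      (by linarith : p - 1 ≤ 1)
  have hK := (constK_pos hp).le
  unfold templateConst
  calc _ ≤ β * 9 + 1 * 2 := by gcongr
    _ ≤ _ := by linarith

/-- The hypotheses cost factors 11(1 + M) and (1 + M)² inside powers with exponents at most 1; both
bases are at least 1, so the exponents can be dropped. -/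
lemma bound_le_of_le {β p v M T r L l N n : ℝ} (hp : 1 < p) (hβ : 0 < β) (hv : 0 < v)
    (hM : 1 ≤ M) (hT0 : 0 < T) (hT : T ≤ 11 * β) (hr : 0 ≤ r) (hrM : r ^ p ≤ M * v) (hL : 0 < L)
    (hLl : L ≤ M * l) (hN : 0 < N) (hnN : n ≤ M * N) (hn : 0 < n) :
    2 * (T * (v + r ^ p)) ^ (1 / p) * (β * L / N) ^ ((p - 1) / p) ≤
      22 * (1 + M) ^ 3 * β * v ^ (1 / p) * (l / n) ^ ((p - 1) / p) := by
  have hp0 : 0 < p := by linarith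
  have hl : 0 < l := by by_contra! hneg; nlinarith
  have hrp : 0 ≤ r ^ p := Real.rpow_nonneg hr p
  have hq0 : 0 ≤ (p - 1) / p := div_nonneg (by linarith) hp0.le
  have hq1 : (p - 1) / p ≤ 1 := (div_le_one hp0).2 (by linarith)
  have h1p : 1 / p ≤ 1 := (div_le_one hp0).2 hp.le
  have e1 : T * (v + r ^ p) ≤ (11 * (1 + M)) * (β * v) := by
    calc T * (v + r ^ p) ≤ 11 * β * (v + M * v) := by gcongr
      _ = _ := by ring
  have e2 : β * L / N ≤ (1 + M) ^ 2 * (β * (l / n)) := by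
    rw [div_le_iff₀ hN]
    have h3 : 1 ≤ M * N / n := (one_le_div hn).2 hnN
    calc β * L ≤ β * (M * l) * 1 := by rw [mul_one]; gcongr
      _ ≤ β * (M * l) * (M * N / n) := by gcongr
      _ = M ^ 2 * (β * (l / n)) * N := by field_simp
      _ ≤ (1 + M) ^ 2 * (β * (l / n)) * N := by gcongr; linarith
  have h3 : β = β ^ (1 / p) * β ^ ((p - 1) / p) := by
    rw [← Real.rpow_add hβ, ← add_div, add_sub_cancel, div_self hp0.ne', Real.rpow_one]
  have f1 : (11 * (1 + M)) ^ (1 / p) ≤ 11 * (1 + M) := by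
    simpa using Real.rpow_le_rpow_of_exponent_le (by linarith : 1 ≤ 11 * (1 + M)) h1p
  have f2 : ((1 + M) ^ 2) ^ ((p - 1) / p) ≤ (1 + M) ^ 2 := by
    simpa using Real.rpow_le_rpow_of_exponent_le (by nlinarith : 1 ≤ (1 + M) ^ 2) hq1
  calc _ ≤ 2 * ((11 * (1 + M)) * (β * v)) ^ (1 / p) *
        ((1 + M) ^ 2 * (β * (l / n))) ^ ((p - 1) / p) := by gcongr
    _ = 2 * ((11 * (1 + M)) ^ (1 / p) * (β ^ (1 / p) * v ^ (1 / p))) *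
        (((1 + M) ^ 2) ^ ((p - 1) / p) * (β ^ ((p - 1) / p) * (l / n) ^ ((p - 1) / p))) := by
      rw [Real.mul_rpow (x := 11 * (1 + M)) (by positivity) (by positivity),
        Real.mul_rpow hβ.le hv.le,
        Real.mul_rpow (x := (1 + M) ^ 2) (by positivity) (by positivity), Real.mul_rpow hβ.le (by positivity)]
    _ ≤ 2 * ((11 * (1 + M)) * (β ^ (1 / p) * v ^ (1 / p))) *
        ((1 + M) ^ 2 * (β ^ ((p - 1) / p) * (l / n) ^ ((p - 1) / p))) := by gcongr
    _ = 22 * (1 + M) ^ 3 * (β ^ (1 / p) * β ^ ((p - 1) / p)) * v ^ (1 / p) *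
        (l / n) ^ ((p - 1) / p) := by ring
    _ = _ := by rw [← h3]

/-! ### Confidence radii and the order of the bounds -/

section Estimates

variable {E Ω : Type*} [NormedAddCommGroup E] [NormedSpace ℝ E]
  [CompleteSpace E] {mΩ : MeasurableSpace Ω} {P : Measure Ω} [IsProbabilityMeasure P]
  {β p v δ : ℝ} {ℱ : Filtration ℕ mΩ} {X : ℕ → Ω → E} {μ : E}

lemma stronglyMeasurable_empiricalMean {P : Measure Ω} (hX : IsHeavyTailedSequence P ℱ X μ p v)
    (k : ℕ) : StronglyMeasurable[ℱ k] (empiricalMean X k) := by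
  refine (Finset.stronglyMeasurable_fun_sum _ fun m hm => ?_).const_smul _
  rw [Finset.mem_Icc] at hm
  exact (hX.adapted m hm.1).mono (ℱ.mono hm.2)

lemma meanRadius_pos (hv : 0 < v) (hβ : 0 < β) (hδ : 0 < δ) {k : ℕ} (hk : 1 ≤ k) :
    0 < meanRadius p v β δ k := by
  have : (0 : ℝ) < k := by exact_mod_cast hk
  unfold meanRadius
  positivity

lemma momRadius_pos (hv : 0 < v) (hβ : 0 < β) (hδ : 0 ≤ Real.log (1 / δ)) {k : ℕ}
    (hk : momBlocks δ ≤ k) : 0 < momRadius p v β δ k := by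
  have : (0 : ℝ) < momUsed δ k := by exact_mod_cast momUsed_pos hk
  unfold momRadius
  positivity

lemma IsHeavyTailedSequence.measureReal_meanRadius_le (h : IsTwoSmooth (fun x : E => ‖x‖) β)
    (hX : IsHeavyTailedSequence P ℱ X μ p v) (hp : 1 < p) (hp2 : p ≤ 2) (hv : 0 < v)
    (hβ : 0 < β) (hδ : 0 < δ) {k : ℕ} (hk : 1 ≤ k) :
    P.real {ω | meanRadius p v β δ k ≤ ‖empiricalMean X k ω - μ‖} ≤ δ := by
  have hk0 : (0 : ℝ) < k := by exact_mod_cast hk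
  refine (hX.measureReal_empiricalMean_le h hp hp2 hβ hk (meanRadius_pos hv hβ hδ hk)).trans ?_
  rw [meanRadius_rpow (by linarith) hv.le hβ.le hδ.le, meanErr]
  have h2 : (2 : ℝ) ≤ 2 ^ p := by
    simpa using Real.rpow_le_rpow_of_exponent_le (by norm_num : (1 : ℝ) ≤ 2) hp.le
  have hk1 : 0 < (k : ℝ) ^ (p - 1) := by positivity
  have hb : 0 < β ^ p := by positivity
  calc _ = 2 * δ / 2 ^ p := by field_simp
    _ ≤ δ := by
      rw [div_le_iff₀ (by positivity), mul_comm]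
      gcongr

lemma IsHeavyTailedSequence.measureReal_momRadius_le (h : IsTwoSmooth (fun x : E => ‖x‖) β)
    (hX : IsHeavyTailedSequence P ℱ X μ p v) (hp : 1 < p) (hp2 : p ≤ 2) (hv : 0 < v)
    (hβ : 0 < β) (hδ : 0 < δ) (hδ1 : δ ≤ 1) {k : ℕ} (hk : momBlocks δ ≤ k) {Z : Ω → E}
    (hZ : IsGeometricMedianOfMeans P X δ k Z) :
    P.real {ω | momRadius p v β δ k ≤ ‖Z ω - μ‖} ≤ δ := by
  have hl : 0 ≤ Real.log (1 / δ) := Real.log_nonneg (by rwa [le_div_iff₀ hδ, one_mul])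
  set B := momBlocks δ with hB
  set N := k / B with hN
  have hB0 : (0 : ℝ) < B := by exact_mod_cast momBlocks_pos δ
  have hNn : 0 < N := Nat.div_pos hk (momBlocks_pos δ)
  have hN0 : (0 : ℝ) < N := by exact_mod_cast hNn
  have hu : (momUsed δ k : ℝ) = B * N := by rw [momUsed]; push_cast; rfl
  set c := 3.5 * Real.log (1 / δ) + 1 with hc
  have hc0 : 0 < c := by positivity
  have hBc : (B : ℝ) ≤ c := momBlocks_le hl
  have hr := momRadius_pos (p := p) hv hβ hl hk
  -- The geometric median may lose a factor 11/2 over the accuracy of the blocks.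
  set s := 2 / 11 * momRadius p v β δ k with hs
  have hs0 : 0 < s := by positivity
  have hsp : s ^ p = 2 ^ p * β ^ p * v * 10 * (c / (B * N)) ^ (p - 1) := by
    rw [hs, Real.mul_rpow (by positivity) hr.le, momRadius_rpow (by linarith) hv.le hβ.le hl,
      momErr, Real.div_rpow (by positivity) (by positivity), hu, ← hc]
    field_simp
  have h2 : (2 : ℝ) ≤ 2 ^ p := by
    simpa using Real.rpow_le_rpow_of_exponent_le (by norm_num : (1 : ℝ) ≤ 2) hp.le
  have hγ : 2 * β ^ p * v / ((N : ℝ) ^ (p - 1) * s ^ p) ≤ 1 / 10 := by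
    -- The numerator c in the radius dominates the number of blocks B, so c / (B N) is at least 1 /
    -- N, the reciprocal of the block length.
    have h3 : (1 : ℝ) ≤ (N : ℝ) ^ (p - 1) * (c / (B * N)) ^ (p - 1) := by
      rw [← Real.mul_rpow hN0.le (by positivity)]
      refine Real.one_le_rpow ?_ (by linarith)
      rw [show (N : ℝ) * (c / (B * N)) = c / B by field_simp, one_le_div hB0]
      exact hBc
    rw [hsp, div_le_div_iff₀ (by positivity) (by norm_num)]
    calc 2 * β ^ p * v * 10 = 2 * (β ^ p * v * 10) * 1 := by ring
      _ ≤ 2 ^ p * (β ^ p * v * 10) * ((N : ℝ) ^ (p - 1) * (c / (B * N)) ^ (p - 1)) := by gcongr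
      _ = _ := by ring
  refine le_trans ?_ ((hX.measureReal_sum_indicator_ge_le h hp hp2 hβ hNn hs0 hγ B).trans
    (exp_neg_momBlocks_le hδ))
  refine ENNReal.toReal_mono (measure_ne_top _ _) (measure_mono_ae ?_)
  filter_upwards [hZ] with ω hω hbad
  have h4 := hω.card_le hs0 (x := μ) (by
    rw [hs, ← mul_assoc]; norm_num; exact hbad)
  rw [Fintype.card_fin] at h4
  refine h4.trans (le_of_eq ?_)
  rw [← Fin.sum_univ_eq_sum_range (fun b => Set.indicator
    {ω | s ≤ ‖blockMean X N b ω - μ‖} (1 : Ω → ℝ) ω) B]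
  refine Finset.sum_congr rfl fun b _ => ?_
  simp only [Set.indicator, Set.mem_ofPred_eq, Pi.one_apply, ← hB, ← hN]

lemma IsHeavyTailedSequence.truncatedMean_optLam_order (h : IsTwoSmooth (fun x : E => ‖x‖) β)
    (hX : IsHeavyTailedSequence P ℱ X μ p v) (hp : 1 < p) (hp2 : p ≤ 2) (hv : 0 < v) (hβ : 0 < β)
    {δ₁ δ₂ M C : ℝ} (hδ₁ : 0 < δ₁) (hδ₂ : 0 < δ₂) (hδ : δ = δ₁ + δ₂) (hδ1 : δ ≤ 1)
    (hC : 22 * (1 + |M|) ^ 3 ≤ C) {r : ℝ} {k n : ℕ} {Z : Ω → E} (hr : 0 ≤ r) (hkn : k < n)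
    (hZ : StronglyMeasurable[ℱ k] Z) (hZr : P.real {ω | r ≤ ‖Z ω - μ‖} ≤ δ₂)
    (hrM : r ^ p ≤ M * v) (hnM : (n : ℝ) ≤ M * ((n : ℝ) - k))
    (hLM : Real.log (2 / δ₁) ≤ M * Real.log (1 / δ)) :
    1 - δ ≤ P.real {ω | ‖truncatedMean X Z (optLam E p v β δ₁ r k n) k n ω - μ‖ ≤
      C * β * v ^ (1 / p) * (Real.log (1 / δ) / n) ^ ((p - 1) / p)} := by
  have hδ0 : 0 < δ := by linarith
  have hl : 0 ≤ Real.log (1 / δ) := Real.log_nonneg (by rwa [le_div_iff₀ hδ0, one_mul])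
  have hC0 : 0 ≤ C := le_trans (by positivity) hC
  have hL : 0 < Real.log (2 / δ₁) := Real.log_pos (by rw [lt_div_iff₀ hδ₁]; linarith)
  have hN : 0 < (n : ℝ) - k := by rw [sub_pos]; exact_mod_cast hkn
  have hn : (0 : ℝ) < n := by exact_mod_cast (Nat.zero_le k).trans_lt hkn
  -- Forced by n ≤ M(n - k) and n - k ≤ n.
  have hM : 1 ≤ M := by
    by_contra! hlt
    have : (0 : ℝ) ≤ k := Nat.cast_nonneg k
    nlinarith
  -- On the zero space β may be less than 1, so `templateConst_le` is not available, but the error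
  -- vanishes.
  rcases subsingleton_or_nontrivial E with hE | hE
  · have huniv : {ω | ‖truncatedMean X Z (optLam E p v β δ₁ r k n) k n ω - μ‖ ≤
        C * β * v ^ (1 / p) * (Real.log (1 / δ) / n) ^ ((p - 1) / p)} = Set.univ := by
      refine Set.eq_univ_of_forall fun ω => ?_
      rw [Set.mem_ofPred_eq, Subsingleton.elim (truncatedMean X Z _ k n ω - μ) 0, norm_zero]
      positivity
    rw [huniv, probReal_univ]
    linarith
  · have hmain := hX.truncatedMean_optLam h hp hp2 hv hβ hδ₁ (by linarith) hr hkn hZ hZr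
    rw [← hδ] at hmain
    refine hmain.trans (measureReal_mono fun ω hω => ?_)
    rw [abs_of_nonneg (by linarith)] at hC
    rw [Set.mem_ofPred_eq] at hω ⊢
    refine hω.trans ((bound_le_of_le hp hβ hv hM
      (templateConst_pos E hp hβ) (templateConst_le E hp hp2 (h.one_le hβ)) hr hrM hL hLM hN hnM
      hn).trans ?_)
    gcongr

end Estimates

theorem mainTheorem5 (M : ℝ) :
    ∃ C : ℝ, 0 < C ∧
      ∀ (E : Type u) [NormedAddCommGroup E] [NormedSpace ℝ E] [CompleteSpace E]
        [TopologicalSpace.SeparableSpace E]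
        (Ω : Type w) (mΩ : MeasurableSpace Ω) (P : Measure Ω) [IsProbabilityMeasure P]
        (ℱ : Filtration ℕ mΩ) (X : ℕ → Ω → E) (μ : E) (p v β : ℝ),
        1 < p → p ≤ 2 → 0 < v → 0 < β →
        IsTwoSmooth (fun x : E => ‖x‖) β →
        IsHeavyTailedSequence P ℱ X μ p v →
        ∀ δ δ₁ δ₂ : ℝ, 0 < δ₁ → 0 < δ₂ → δ = δ₁ + δ₂ → δ ≤ 1 →
          -- an arbitrary initial estimate
          (∀ k n : ℕ, k < n → ∀ (Z : Ω → E) (r : ℝ), StronglyMeasurable[ℱ k] Z → 0 ≤ r →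
            P.real {ω | r ≤ ‖Z ω - μ‖} ≤ δ₂ →
            1 - δ ≤ P.real {ω |
              ‖truncatedMean X Z (optLam E p v β δ₁ r k n) k n ω - μ‖ ≤
                2 * (templateConst E p β * (v + r ^ p)) ^ (1 / p) *
                  (β * Real.log (2 / δ₁) / ((n : ℝ) - k)) ^ ((p - 1) / p)} ∧
            (r ^ p ≤ M * v → (n : ℝ) ≤ M * ((n : ℝ) - k) →
              Real.log (2 / δ₁) ≤ M * Real.log (1 / δ) →
              1 - δ ≤ P.real {ω |
                ‖truncatedMean X Z (optLam E p v β δ₁ r k n) k n ω - μ‖ ≤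
                  C * β * v ^ (1 / p) * (Real.log (1 / δ) / n) ^ ((p - 1) / p)})) ∧
          -- the empirical mean as initial estimate
          (∀ k n : ℕ, 1 ≤ k → k < n →
            1 - δ ≤ P.real {ω |
              ‖truncatedMean X (empiricalMean X k)
                  (optLam E p v β δ₁ (meanRadius p v β δ₂ k) k n) k n ω - μ‖ ≤
                2 * β * (v * leadConst E p β) ^ (1 / p) * (1 + meanErr p β δ₂ k) ^ (1 / p) *
                  (Real.log (2 / δ₁) / ((n : ℝ) - k)) ^ ((p - 1) / p)} ∧
            (meanErr p β δ₂ k ≤ M → (n : ℝ) ≤ M * ((n : ℝ) - k) →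
              Real.log (2 / δ₁) ≤ M * Real.log (1 / δ) →
              1 - δ ≤ P.real {ω |
                ‖truncatedMean X (empiricalMean X k)
                    (optLam E p v β δ₁ (meanRadius p v β δ₂ k) k n) k n ω - μ‖ ≤
                  C * β * v ^ (1 / p) * (Real.log (1 / δ) / n) ^ ((p - 1) / p)})) ∧
          Tendsto (fun k : ℕ => meanErr p β δ₂ k) atTop (𝓝 0) ∧
          (∀ k : ℕ, 1 ≤ k → meanErr p β δ₂ k ≤ C * (β ^ p / (δ₂ * (k : ℝ) ^ (p - 1)))) ∧
          -- the geometric median-of-means as initial estimate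
          (∀ k n : ℕ, momBlocks δ₂ ≤ k → k < n → ∀ Z : Ω → E, StronglyMeasurable[ℱ k] Z →
            IsGeometricMedianOfMeans P X δ₂ k Z →
            1 - δ ≤ P.real {ω |
              ‖truncatedMean X Z
                  (optLam E p v β δ₁ (momRadius p v β δ₂ k) k n) k n ω - μ‖ ≤
                2 * β * (v * leadConst E p β) ^ (1 / p) * (1 + momErr p β δ₂ k) ^ (1 / p) *
                  (Real.log (2 / δ₁) / ((n : ℝ) - k)) ^ ((p - 1) / p)} ∧
            (momErr p β δ₂ k ≤ M → (n : ℝ) ≤ M * ((n : ℝ) - k) →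
              Real.log (2 / δ₁) ≤ M * Real.log (1 / δ) →
              1 - δ ≤ P.real {ω |
                ‖truncatedMean X Z
                    (optLam E p v β δ₁ (momRadius p v β δ₂ k) k n) k n ω - μ‖ ≤
                  C * β * v ^ (1 / p) * (Real.log (1 / δ) / n) ^ ((p - 1) / p)})) ∧
          Tendsto (fun k : ℕ => momErr p β δ₂ k) atTop (𝓝 0) ∧
          (∀ k : ℕ, momBlocks δ₂ ≤ k →
            momErr p β δ₂ k ≤ C * (β ^ p * ((1 + Real.log (1 / δ₂)) / k) ^ (p - 1))) := by
  -- The first summand serves the order bounds; 8470 is the constant of `momErr_le` and exceeds the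
  -- constant 4 of `meanErr_le`.
  refine ⟨22 * (1 + |M|) ^ 3 + 8470, by positivity, ?_⟩
  intro E _ _ _ _ Ω mΩ P _ ℱ X μ p v β hp hp2 hv hβ h hX δ δ₁ δ₂ hδ₁ hδ₂ hδ hδ1
  have hl : 0 ≤ Real.log (1 / δ₂) :=
    Real.log_nonneg (by rw [le_div_iff₀ hδ₂, one_mul]; linarith)
  have hL : 0 ≤ Real.log (2 / δ₁) := Real.log_nonneg (by rw [le_div_iff₀ hδ₁]; linarith)
  have hC : 22 * (1 + |M|) ^ 3 ≤ 22 * (1 + |M|) ^ 3 + 8470 := by linarith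
  have hC0 : 0 ≤ 22 * (1 + |M|) ^ 3 := by positivity
  refine ⟨fun k n hkn Z r hZ hr hZr => ⟨?_, ?_⟩, fun k n hk hkn => ⟨?_, ?_⟩,
    tendsto_meanErr hp hδ₂, fun k _ => ?_, fun k n hk hkn Z hZ hZm => ⟨?_, ?_⟩,
    tendsto_momErr hp, fun k hk => ?_⟩
  · rw [hδ]
    exact hX.truncatedMean_optLam h hp hp2 hv hβ hδ₁ (by linarith) hr hkn hZ hZr
  · exact hX.truncatedMean_optLam_order h hp hp2 hv hβ hδ₁ hδ₂ hδ hδ1 hC hr hkn hZ hZr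
  · have h1 := hX.truncatedMean_optLam h hp hp2 hv hβ hδ₁ (by linarith)
      (meanRadius_pos hv hβ hδ₂ hk).le hkn (stronglyMeasurable_empiricalMean hX k)
      (hX.measureReal_meanRadius_le h hp hp2 hv hβ hδ₂ hk)
    rwa [meanRadius_rpow (by linarith) hv.le hβ.le hδ₂.le, bound_eq_leadConst E hp hβ hv
      (by unfold meanErr; positivity) hL (by rw [sub_pos]; exact_mod_cast hkn), ← hδ] at h1
  · intro hM
    refine hX.truncatedMean_optLam_order h hp hp2 hv hβ hδ₁ hδ₂ hδ hδ1 hC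
      (meanRadius_pos hv hβ hδ₂ hk).le hkn (stronglyMeasurable_empiricalMean hX k)
      (hX.measureReal_meanRadius_le h hp hp2 hv hβ hδ₂ hk) ?_
    rw [meanRadius_rpow (by linarith) hv.le hβ.le hδ₂.le, mul_comm]
    gcongr
  · refine (meanErr_le hp2 hβ hδ₂ k).trans ?_
    gcongr
    linarith
  · have h1 := hX.truncatedMean_optLam h hp hp2 hv hβ hδ₁ (by linarith)
      (momRadius_pos hv hβ hl hk).le hkn hZ
      (hX.measureReal_momRadius_le h hp hp2 hv hβ hδ₂ (by linarith) hk hZm)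
    rwa [momRadius_rpow (by linarith) hv.le hβ.le hl, bound_eq_leadConst E hp hβ hv
      (by unfold momErr; positivity) hL (by rw [sub_pos]; exact_mod_cast hkn), ← hδ] at h1
  · intro hM
    refine hX.truncatedMean_optLam_order h hp hp2 hv hβ hδ₁ hδ₂ hδ hδ1 hC
      (momRadius_pos hv hβ hl hk).le hkn hZ
      (hX.measureReal_momRadius_le h hp hp2 hv hβ hδ₂ (by linarith) hk hZm) ?_
    rw [momRadius_rpow (by linarith) hv.le hβ.le hl, mul_comm]
    gcongr
  · refine (momErr_le hp hp2 hβ hl hk).trans ?_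
    gcongr
    linarith
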